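/- Let $\mathbb K$ be $\mathbb R$ or $\mathbb C$ and let $M,N\ge 1$. Let $\{\lambda_m\}_{m=1}^M$ and $\{\mu_n\}_{n=1}^N$ be nonnegative nonincreasing real sequences. Spectra are counted with multiplicity and listed in nonincreasing order. For a finite sequence of vectors $F=\{f_n\}_{n=1}^N$ in $\mathbb K^M$, identified with the $M\times N$ matrix with columns $f_n$, the frame operator is $FF^*=\sum_{n=1}^N f_nf_n^*$, and $F_n=\{f_{n'}\}_{n'=1}^n$. **Eigensteps.** A sequence of eigensteps for these data is a family $\{\{\lambda_{n;m}\}_{m=1}^M\}_{n=0}^N$ of nonnegative nonincreasing sequences such that $\lambda_{0;m}=0$ and $\lambda_{N;m}=\lambda_m$ for all $m$; for all $n=1,\dots,N$, $$\lambda_{n-1;M}\le\lambda_{n;M}\le\lambda_{n-1;M-1}\le\lambda_{n;M-1}\le\cdots\le\lambda_{n-1;1}\le\lambda_{n;1};$$ and $\sum_{m=1}^M\lambda_{n;m}=\sum_{n'=1}^n\mu_{n'}$ for all $n=1,\dots,N$. **Algorithm.** (A) Pick a sequence of eigensteps. (B) Let $U_1=\{u_{1;m}\}_{m=1}^M$ be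 any $M\times M$ unitary matrix over $\mathbb K$ and let $f_1=\sqrt{\mu_1}\,u_{1;1}$, where $u_{1;1}$ is the first column of $U_1$. For each $n=1,\dots,N-1$: 1. Let $V_n$ be any $M\times M$ block-diagonal unitary matrix over $\mathbb K$ whose blocks correspond to the distinct values of $\{\lambda_{n;m}\}_{m=1}^M$, the size of each block being the multiplicity of the corresponding value. 2. Let $\mathcal I_n\subseteq\{1,\dots,M\}$ be the set of those $m$ such that $\lambda_{n;m}<\lambda_{n;m'}$ for all $m'<m$ and such that the multiplicity of $\lambda_{n;m}$ as a value in $\{\lambda_{n;m'}\}_{m'=1}^M$ exceeds its multiplicity as a value in $\{\lambda_{n+1;m'}\}_{m'=1}^M$. Let $\mathcal J_n$ be the set of those $m$ such that $\lambda_{n+1;m}<\lambda_{n+1;m'}$ for all $m'<m$ and such that the multiplicity of $\lambda_{n+1;m}$ as a value in $\{\lambda_{n+1;m'}\}_{m'=1}^M$ exceeds its multiplicity as a value in $\{\lambda_{n;m'}\}_{m'=1}^M$. The sets $\mathcal I_n$ and $\mathcal J_n$ have equal cardinality, denoted $R_n$. For $\mathcal S\in\{\mathcal I_n,\mathcal J_n\}$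 let $\pi_{\mathcal S}$ be the unique permutation of $\{1,\dots,M\}$ that is increasing on $\mathcal S$ and on $\mathcal S^{\mathrm c}$ and maps $\mathcal S$ onto $\{1,\dots,R_n\}$, and let $\Pi_{\mathcal S}$ be the permutation matrix with $\Pi_{\mathcal S}\delta_m=\delta_{\pi_{\mathcal S}(m)}$. 3. Let $v_n,w_n\in\mathbb R^{R_n}$ be the vectors with entries, for $m\in\mathcal I_n$ and $m'\in\mathcal J_n$, $$v_n(\pi_{\mathcal I_n}(m))=\left[-\frac{\prod_{m''\in\mathcal J_n}(\lambda_{n;m}-\lambda_{n+1;m''})}{\prod_{m''\in\mathcal I_n,\,m''\ne m}(\lambda_{n;m}-\lambda_{n;m''})}\right]^{1/2},\qquad w_n(\pi_{\mathcal J_n}(m'))=\left[\frac{\prod_{m''\in\mathcal I_n}(\lambda_{n+1;m'}-\lambda_{n;m''})}{\prod_{m''\in\mathcal J_n,\,m''\ne m'}(\lambda_{n+1;m'}-\lambda_{n+1;m''})}\right]^{1/2}.$$ 4. Let $f_{n+1}=U_nV_n\Pi_{\mathcal I_n}^{\mathrm T}\begin{bmatrix}v_n\\0\end{bmatrix}$,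 where $v_n$ is padded with $M-R_n$ zeros. 5. Let $U_{n+1}=U_nV_n\Pi_{\mathcal I_n}^{\mathrm T}\begin{bmatrix}W_n&0\\0&\mathrm I\end{bmatrix}\Pi_{\mathcal J_n}$, where $W_n$ is the $R_n\times R_n$ matrix with entries $$W_n(\pi_{\mathcal I_n}(m),\pi_{\mathcal J_n}(m'))=\frac{1}{\lambda_{n+1;m'}-\lambda_{n;m}}\,v_n(\pi_{\mathcal I_n}(m))\,w_n(\pi_{\mathcal J_n}(m')),\qquad m\in\mathcal I_n,\ m'\in\mathcal J_n.$$ **Theorem.** (i) Every sequence of vectors $F=\{f_n\}_{n=1}^N$ in $\mathbb K^M$ whose frame operator $FF^*$ has spectrum $\{\lambda_m\}_{m=1}^M$ and which satisfies $\|f_n\|^2=\mu_n$ for all $n$ is produced by this algorithm, for a suitable choice of eigensteps and of $U_1,V_1,\dots,V_{N-1}$. (ii) Conversely, for every choice of eigensteps each step of the algorithm is well defined: $\mathcal I_n$ and $\mathcal J_n$ have equal cardinality, no denominator above vanishes, and the quantities under the square roots are positive. Every $F$ produced by the algorithm has $\{\lambda_m\}_{m=1}^M$ as the spectrum of $FF^*$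 and satisfies $\|f_n\|^2=\mu_n$ for all $n$. (iii) Moreover, for every $F$ produced by the algorithm and every $n=1,\dots,N$, the spectrum of $F_nF_n^*$ is $\{\lambda_{n;m}\}_{m=1}^M$, and the columns of $U_n$ form an orthonormal basis of $\mathbb K^M$ consisting of eigenvectors of $F_nF_n^*$, the $m$-th column having eigenvalue $\lambda_{n;m}$. -/

import Mathlib

open scoped Matrix

namespace FrameSteps

/-! ### Eigensteps

Sequences of length `M` are functions on `Fin M`; the index `m` of the text is the element of
`Fin M` with value `m - 1`. -/

/-- `γ` interlaces on `β`:
`β_M ≤ γ_M ≤ β_{M-1} ≤ γ_{M-1} ≤ ⋯ ≤ β_2 ≤ γ_2 ≤ β_1 ≤ γ_1`. -/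
structure Interlaces {M : ℕ} (β γ : Fin M → ℝ) : Prop where
  le : ∀ m, β m ≤ γ m
  succ_le : ∀ m m' : Fin M, (m : ℕ) + 1 = (m' : ℕ) → γ m' ≤ β m

/-- `Λ` is a sequence of eigensteps for `lam = {λ_m}_{m=1}^M` and `mu = {μ_n}_{n=1}^N`.
The value `Λ n m` is `λ_{n;m}`, with `n` in `Fin (N + 1) = {0, …, N}`. -/
structure IsEigensteps {M N : ℕ} (lam : Fin M → ℝ) (mu : Fin N → ℝ)
    (Λ : Fin (N + 1) → Fin M → ℝ) : Prop where
  nonneg : ∀ n m, 0 ≤ Λ n m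
  antitone : ∀ n, Antitone (Λ n)
  initial : ∀ m, Λ 0 m = 0
  final : ∀ m, Λ (Fin.last N) m = lam m
  interlaces : ∀ n : Fin N, Interlaces (Λ n.castSucc) (Λ n.succ)
  trace : ∀ n : Fin N, ∑ m, Λ n.succ m = ∑ n' ∈ Finset.Iic n, mu n'

/-! ### Frame operators and spectra -/

section Operators

variable {𝕜 : Type*} [RCLike 𝕜] {M : ℕ}

/-- The synthesis matrix of a sequence of vectors: its columns are the vectors. -/
def synthesis {N : ℕ} (f : Fin N → EuclideanSpace 𝕜 (Fin M)) : Matrix (Fin M) (Fin N) 𝕜 :=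
  Matrix.of fun i n => f n i

/-- The frame operator `F F*`, as an `M × M` matrix. -/
noncomputable def frameOperator {N : ℕ} (f : Fin N → EuclideanSpace 𝕜 (Fin M)) :
    Matrix (Fin M) (Fin M) 𝕜 :=
  synthesis f * (synthesis f)ᴴ

/-- The partial sequence consisting of the vectors of `f` up to and including `f n`. -/
def partialSeq {N : ℕ} (f : Fin N → EuclideanSpace 𝕜 (Fin M)) (n : Fin N) :
    Fin ((n : ℕ) + 1) → EuclideanSpace 𝕜 (Fin M) :=
  fun j => f (Fin.castLE n.isLt j)

/-- `A` has spectrum `{α_m}_{m=1}^M`, counted with multiplicity. -/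
def HasSpectrum (A : Matrix (Fin M) (Fin M) 𝕜) (α : Fin M → ℝ) : Prop :=
  A.charpoly = ∏ m, (Polynomial.X - Polynomial.C ((α m : ℝ) : 𝕜))

/-- The `m`-th column of `U`, as a vector of the Hilbert space `𝕜^M`. -/
def column (U : Matrix (Fin M) (Fin M) 𝕜) (m : Fin M) : EuclideanSpace 𝕜 (Fin M) :=
  WithLp.toLp 2 fun i => U i m

/-- The columns of `U` form an orthonormal basis of eigenvectors of `A`, the `m`-th column
having eigenvalue `α m`. -/
def IsOrthonormalEigenbasis (U A : Matrix (Fin M) (Fin M) 𝕜) (α : Fin M → ℝ) : Prop :=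
  ∃ b : OrthonormalBasis (Fin M) 𝕜 (EuclideanSpace 𝕜 (Fin M)),
    ∀ m, b m = column U m ∧ Matrix.toEuclideanLin A (b m) = ((α m : ℝ) : 𝕜) • b m

/-- For nonincreasing `α`: `V` is a block-diagonal unitary matrix whose diagonal blocks
correspond to the distinct values of `α`, each block having the multiplicity of the
corresponding value as its size. -/
def IsBlockUnitary (α : Fin M → ℝ) (V : Matrix (Fin M) (Fin M) 𝕜) : Prop :=
  V ∈ Matrix.unitaryGroup (Fin M) 𝕜 ∧ ∀ i j, α i ≠ α j → V i j = 0

end Operators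

/-! ### Index sets and their permutations -/

section IndexSets

variable {M : ℕ}

/-- The multiplicity of `x` as a value of the sequence `α`. -/
noncomputable def valueMult (α : Fin M → ℝ) (x : ℝ) : ℕ :=
  (Finset.univ.filter fun m => α m = x).card

/-- The indices `m` at which a value of `α` occurs for the first time (that is, `α m < α m'` for
all `m' < m`) and such that `α m` has greater multiplicity in `α` than in `β`.
With `α = λ_n` and `β = λ_{n+1}` this is `𝓘_n`; with the roles exchanged it is `𝓙_n`. -/
noncomputable def indexSet (α β : Fin M → ℝ) : Finset (Fin M) :=
  Finset.univ.filter fun m =>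
    (∀ m' < m, α m < α m') ∧ valueMult β (α m) < valueMult α (α m)

theorem card_le_dim (S : Finset (Fin M)) : S.card ≤ M :=
  (Finset.card_le_univ S).trans_eq (Fintype.card_fin M)

/-- The permutation `π_S` that maps `S` increasingly onto the first `|S|` indices and the
complement of `S` increasingly onto the remaining ones. -/
def sortPerm (S : Finset (Fin M)) : Equiv.Perm (Fin M) :=
  ((finSumEquivOfFinset (s := S) (m := S.card) (n := M - S.card) rfl
      (by rw [Finset.card_compl, Fintype.card_fin])).symm.trans finSumFinEquiv).trans
    (finCongr (Nat.add_sub_cancel' (card_le_dim S)))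

/-- `π` is increasing on `S` and on its complement, and maps `S` into the first `|S|` indices. -/
structure IsSortPerm (S : Finset (Fin M)) (π : Equiv.Perm (Fin M)) : Prop where
  mono : StrictMonoOn π (S : Set (Fin M))
  mono_compl : StrictMonoOn π ((S : Set (Fin M))ᶜ)
  lt_card : ∀ m ∈ S, (π m : ℕ) < S.card

end IndexSets

/-! ### One step of the recursion -/

section Step

variable {M : ℕ}

/-- The radicand of the entry of `v` that belongs to the index `m ∈ 𝓘`. Here `α`, `β` are two
consecutive sequences of eigensteps. -/
noncomputable def radicandV (α β : Fin M → ℝ) (m : Fin M) : ℝ :=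
  -((∏ m'' ∈ indexSet β α, (α m - β m'')) / ∏ m'' ∈ (indexSet α β).erase m, (α m - α m''))

/-- The radicand of the entry of `w` that belongs to the index `m' ∈ 𝓙`. -/
noncomputable def radicandW (α β : Fin M → ℝ) (m' : Fin M) : ℝ :=
  (∏ m'' ∈ indexSet α β, (β m' - α m'')) / ∏ m'' ∈ (indexSet β α).erase m', (β m' - β m'')

/-- The index `π_S⁻¹ (r)` for `r` among the first `|S|` indices. -/
def sortIndex (S : Finset (Fin M)) (r : Fin S.card) : Fin M :=
  (sortPerm S).symm (Fin.castLE (card_le_dim S) r)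

/-- The vector `v`, with `v (π_𝓘 m) = (radicandV α β m)^{1/2}` for `m ∈ 𝓘`. -/
noncomputable def stepV (α β : Fin M → ℝ) (r : Fin (indexSet α β).card) : ℝ :=
  Real.sqrt (radicandV α β (sortIndex _ r))

/-- The vector `w`, with `w (π_𝓙 m') = (radicandW α β m')^{1/2}` for `m' ∈ 𝓙`. -/
noncomputable def stepW (α β : Fin M → ℝ) (r : Fin (indexSet β α).card) : ℝ :=
  Real.sqrt (radicandW α β (sortIndex _ r))

/-- The matrix `W`, with
`W (π_𝓘 m) (π_𝓙 m') = (β m' - α m)⁻¹ * v (π_𝓘 m) * w (π_𝓙 m')` for `m ∈ 𝓘`, `m' ∈ 𝓙`. -/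
noncomputable def stepMatrix (α β : Fin M → ℝ) :
    Matrix (Fin (indexSet α β).card) (Fin (indexSet β α).card) ℝ :=
  Matrix.of fun r r' =>
    1 / (β (sortIndex _ r') - α (sortIndex _ r)) * stepV α β r * stepW α β r'

variable (𝕜 : Type*) [RCLike 𝕜]

/-- The permutation matrix `Π_S`, with `Π_S δ_m = δ_{π_S(m)}`. -/
def permMat (S : Finset (Fin M)) : Matrix (Fin M) (Fin M) 𝕜 :=
  Equiv.Perm.permMatrix 𝕜 (sortPerm S).symm

/-- The vector `v` padded with zeros to length `M`. -/
def padVec (M : ℕ) {p : ℕ} (v : Fin p → ℝ) : Fin M → 𝕜 :=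
  fun k => if h : (k : ℕ) < p then ((v ⟨k, h⟩ : ℝ) : 𝕜) else 0

/-- The `M × M` matrix `diag(W, I)`; in use, `p = q`. -/
def padBlock (M : ℕ) {p q : ℕ} (W : Matrix (Fin p) (Fin q) ℝ) : Matrix (Fin M) (Fin M) 𝕜 :=
  Matrix.of fun k l =>
    if h : (k : ℕ) < p ∧ (l : ℕ) < q then ((W ⟨k, h.1⟩ ⟨l, h.2⟩ : ℝ) : 𝕜)
    else if k = l then 1 else 0

variable {𝕜}

/-- The vector `f_{n+1} = U_n V_n Π_𝓘ᵀ [v; 0]`. -/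
noncomputable def nextVector (α β : Fin M → ℝ) (U V : Matrix (Fin M) (Fin M) 𝕜) :
    EuclideanSpace 𝕜 (Fin M) :=
  WithLp.toLp 2
    ((U * V * (permMat 𝕜 (indexSet α β))ᵀ) *ᵥ padVec 𝕜 M (stepV α β))

/-- The matrix `U_{n+1} = U_n V_n Π_𝓘ᵀ diag(W, I) Π_𝓙`. -/
noncomputable def nextBasis (α β : Fin M → ℝ) (U V : Matrix (Fin M) (Fin M) 𝕜) :
    Matrix (Fin M) (Fin M) 𝕜 :=
  U * V * (permMat 𝕜 (indexSet α β))ᵀ * padBlock 𝕜 M (stepMatrix α β) *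
    permMat 𝕜 (indexSet β α)

/-! ### The recursion

The number of vectors is `N = K + 1`. Sequences indexed by `n = 1, …, N` (the vectors `f_n`, the
matrices `U_n`) are functions on `Fin (K + 1)`, those indexed by `n = 1, …, N - 1` (the steps, the
matrices `V_n`) are functions on `Fin K`. So `k : Fin K` stands for the step `n = k + 1`, which
uses the eigensteps `λ_n = Λ k.castSucc.succ` and `λ_{n+1} = Λ k.succ.succ`. -/

variable {K : ℕ}

/-- The matrices `U_1, …, U_N` computed from the eigensteps, `U_1` and `V_1, …, V_{N-1}`. -/
noncomputable def bases (Λ : Fin (K + 1 + 1) → Fin M → ℝ) (U₁ : Matrix (Fin M) (Fin M) 𝕜)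
    (V : Fin K → Matrix (Fin M) (Fin M) 𝕜) : Fin (K + 1) → Matrix (Fin M) (Fin M) 𝕜 :=
  Fin.induction (motive := fun _ => Matrix (Fin M) (Fin M) 𝕜) U₁
    fun k U => nextBasis (Λ k.castSucc.succ) (Λ k.succ.succ) U (V k)

/-- The vectors `f_1, …, f_N` computed from the lengths, the eigensteps, `U_1` and
`V_1, …, V_{N-1}`; here `f_1 = √μ_1 u_{1;1}`. -/
noncomputable def vectors [NeZero M] (mu : Fin (K + 1) → ℝ) (Λ : Fin (K + 1 + 1) → Fin M → ℝ)
    (U₁ : Matrix (Fin M) (Fin M) 𝕜) (V : Fin K → Matrix (Fin M) (Fin M) 𝕜) :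
    Fin (K + 1) → EuclideanSpace 𝕜 (Fin M) :=
  Fin.cons (α := fun _ => EuclideanSpace 𝕜 (Fin M))
    (((Real.sqrt (mu 0) : ℝ) : 𝕜) • column U₁ 0)
    fun k => nextVector (Λ k.castSucc.succ) (Λ k.succ.succ) (bases Λ U₁ V k.castSucc) (V k)

/-- Admissible choices of the unitary matrices: `U_1` is any unitary matrix, and each `V_n` is any
block-diagonal unitary matrix with blocks corresponding to the distinct values of `λ_n`. -/
structure IsChoice (Λ : Fin (K + 1 + 1) → Fin M → ℝ) (U₁ : Matrix (Fin M) (Fin M) 𝕜)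
    (V : Fin K → Matrix (Fin M) (Fin M) 𝕜) : Prop where
  unitary : U₁ ∈ Matrix.unitaryGroup (Fin M) 𝕜
  blocks : ∀ k : Fin K, IsBlockUnitary (Λ k.castSucc.succ) (V k)

/-- The step from `α = λ_n` to `β = λ_{n+1}` is well defined: `𝓘_n` and `𝓙_n` have the same
cardinality, the quantities under the square roots are positive (in particular the denominators
do not vanish), and the denominators in `W_n` do not vanish. -/
structure StepWellDefined (α β : Fin M → ℝ) : Prop where
  card_eq : (indexSet α β).card = (indexSet β α).card
  radicandV_pos : ∀ m ∈ indexSet α β, 0 < radicandV α β m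
  radicandW_pos : ∀ m' ∈ indexSet β α, 0 < radicandW α β m'
  denom_ne : ∀ m ∈ indexSet α β, ∀ m' ∈ indexSet β α, β m' - α m ≠ 0

end Step

/-! ### Elementary facts about the definitions -/

section Facts

variable {M : ℕ}

theorem sortPerm_orderEmb (S : Finset (Fin M)) (r : Fin S.card) :
    sortPerm S (S.orderEmbOfFin rfl r) = Fin.castLE (card_le_dim S) r := by
  have hc : Sᶜ.card = M - S.card := by rw [Finset.card_compl, Fintype.card_fin]
  have e : (finSumEquivOfFinset (s := S) rfl hc).symm (S.orderEmbOfFin rfl r) = Sum.inl r := by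
    rw [Equiv.symm_apply_eq, finSumEquivOfFinset_inl]
  ext
  simp [sortPerm, e]

theorem sortPerm_orderEmb_compl (S : Finset (Fin M)) (h : Sᶜ.card = M - S.card)
    (r : Fin (M - S.card)) :
    (sortPerm S (Sᶜ.orderEmbOfFin h r) : ℕ) = S.card + r := by
  have e : (finSumEquivOfFinset (s := S) rfl h).symm (Sᶜ.orderEmbOfFin h r) = Sum.inr r := by
    rw [Equiv.symm_apply_eq, finSumEquivOfFinset_inr]
  simp [sortPerm, e]

theorem sortPerm_isSortPerm (S : Finset (Fin M)) : IsSortPerm S (sortPerm S) := by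
  have hc : Sᶜ.card = M - S.card := by rw [Finset.card_compl, Fintype.card_fin]
  refine ⟨?_, ?_, ?_⟩
  · intro a ha b hb hab
    rw [← Finset.range_orderEmbOfFin S rfl] at ha hb
    obtain ⟨r, rfl⟩ := ha
    obtain ⟨s, rfl⟩ := hb
    rw [sortPerm_orderEmb, sortPerm_orderEmb]
    simpa using hab
  · intro a ha b hb hab
    rw [← Finset.coe_compl, ← Finset.range_orderEmbOfFin Sᶜ hc] at ha hb
    obtain ⟨r, rfl⟩ := ha
    obtain ⟨s, rfl⟩ := hb
    rw [Fin.lt_def, sortPerm_orderEmb_compl, sortPerm_orderEmb_compl]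
    have : r < s := by simpa using hab
    have := Fin.lt_def.1 this
    omega
  · intro m hm
    have hm' : m ∈ Set.range (S.orderEmbOfFin rfl) := by
      rw [Finset.range_orderEmbOfFin]; exact hm
    obtain ⟨r, rfl⟩ := hm'
    rw [sortPerm_orderEmb]
    exact r.isLt

/-- `π_S` is the unique permutation with its defining properties. -/
theorem IsSortPerm.eq_sortPerm {S : Finset (Fin M)} {π : Equiv.Perm (Fin M)}
    (h : IsSortPerm S π) : π = sortPerm S := by
  have key : ∀ σ : Equiv.Perm (Fin M), IsSortPerm S σ → ∀ k : Fin M,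
      σ.symm k ∈ S ↔ (k : ℕ) < S.card := by
    intro σ hσ
    have hsub : S.map σ.toEmbedding ⊆ Finset.univ.filter fun k : Fin M => (k : ℕ) < S.card := by
      intro k hk
      obtain ⟨m, hm, rfl⟩ := Finset.mem_map.1 hk
      simpa using hσ.lt_card m hm
    have hcard : (Finset.univ.filter fun k : Fin M => (k : ℕ) < S.card).card = S.card := by
      rw [Fin.card_filter_val_lt]
      exact min_eq_right (card_le_dim S)
    have heq := Finset.eq_of_subset_of_card_le hsub (by rw [hcard, Finset.card_map])
    intro k
    have := congrArg (fun T => k ∈ T) heq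
    simpa using this
  have hp := sortPerm_isSortPerm S
  have mono : ∀ σ : Equiv.Perm (Fin M), IsSortPerm S σ → ∀ k l : Fin M, k < l →
      ((k : ℕ) < S.card ↔ (l : ℕ) < S.card) → σ.symm k < σ.symm l := by
    intro σ hσ k l hkl hiff
    rcases lt_trichotomy (σ.symm k) (σ.symm l) with h1 | h1 | h1
    · exact h1
    · exact absurd (σ.symm.injective h1) hkl.ne
    · exfalso
      by_cases hk : (k : ℕ) < S.card
      · have := hσ.mono ((key σ hσ l).2 (hiff.1 hk)) ((key σ hσ k).2 hk) h1
        simp only [Equiv.apply_symm_apply] at this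
        exact absurd this hkl.not_gt
      · have hl : ¬ (l : ℕ) < S.card := fun hl => hk (hiff.2 hl)
        have := hσ.mono_compl (fun hh => hl ((key σ hσ l).1 hh))
          (fun hh => hk ((key σ hσ k).1 hh)) h1
        simp only [Equiv.apply_symm_apply] at this
        exact absurd this hkl.not_gt
  have hc : Sᶜ.card = M - S.card := by rw [Finset.card_compl, Fintype.card_fin]
  have e1 : ∀ σ : Equiv.Perm (Fin M), IsSortPerm S σ →
      (fun r : Fin S.card => σ.symm (Fin.castLE (card_le_dim S) r)) = S.orderEmbOfFin rfl := by
    intro σ hσ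
    refine Finset.orderEmbOfFin_unique rfl (fun r => (key σ hσ _).2 r.isLt) ?_
    intro r s hrs
    exact mono σ hσ _ _ hrs ⟨fun _ => s.isLt, fun _ => r.isLt⟩
  have e2 : ∀ σ : Equiv.Perm (Fin M), IsSortPerm S σ →
      (fun r : Fin (M - S.card) => σ.symm ⟨S.card + r, by have := r.isLt; omega⟩) =
        Sᶜ.orderEmbOfFin hc := by
    intro σ hσ
    refine Finset.orderEmbOfFin_unique hc (fun r => ?_) ?_
    · rw [Finset.mem_compl, key σ hσ]
      simp
    · intro r s hrs
      refine mono σ hσ _ _ ?_ ?_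
      · rw [Fin.lt_def] at hrs ⊢
        simpa using hrs
      · simp
  have : π.symm = (sortPerm S).symm := by
    ext k
    by_cases hk : (k : ℕ) < S.card
    · have := congrFun ((e1 π h).trans (e1 _ hp).symm) ⟨k, hk⟩
      exact congrArg Fin.val this
    · have := congrFun ((e2 π h).trans (e2 _ hp).symm) ⟨k - S.card, by have := k.isLt; omega⟩
      have hk' : S.card + ((k : ℕ) - S.card) = k := by omega
      simp only [hk'] at this
      exact congrArg Fin.val this
  simpa using congrArg Equiv.symm this

theorem permMat_mulVec_single (𝕜 : Type*) [RCLike 𝕜] (S : Finset (Fin M)) (m : Fin M) :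
    permMat 𝕜 S *ᵥ Pi.single m 1 = Pi.single (sortPerm S m) 1 := by
  ext i
  have e : m = (sortPerm S).symm i ↔ i = sortPerm S m := by
    rw [Equiv.eq_symm_apply, eq_comm]
  simp [permMat, Pi.single_apply, PEquiv.toMatrix_apply, e, eq_comm (b := m)]

/-- `v (π_𝓘 m)` is the square root of the radicand for `m ∈ 𝓘`. -/
theorem stepV_sortPerm (α β : Fin M → ℝ) (m : Fin M) (hm : m ∈ indexSet α β) :
    stepV α β ⟨sortPerm _ m, (sortPerm_isSortPerm _).lt_card m hm⟩ =
      Real.sqrt (radicandV α β m) := by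
  simp [stepV, sortIndex]

/-- `w (π_𝓙 m')` is the square root of the radicand for `m' ∈ 𝓙`. -/
theorem stepW_sortPerm (α β : Fin M → ℝ) (m' : Fin M) (hm : m' ∈ indexSet β α) :
    stepW α β ⟨sortPerm _ m', (sortPerm_isSortPerm _).lt_card m' hm⟩ =
      Real.sqrt (radicandW α β m') := by
  simp [stepW, sortIndex]

end Facts

end FrameSteps

open FrameSteps

/-! The core is a model problem: for antitone `α`, `β` with `Interlaces α β`, find a real vector `v`
and a real orthogonal matrix `R` with `(diag α + v vᵀ) R = R diag β`. Interlacing makes the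
multiplicities of each value in `α` and `β` differ by at most one, so after deleting the entries
indexed by `indexSet α β` and `indexSet β α` the same multiset remains. On that remainder `R` is a
permutation. On the deleted entries all values are distinct, and `v`, `R` are given by Cauchy-type
formulas. Counting values above a threshold gives the signs of the radicands
(`Interlaces.stepWellDefined`). Lagrange interpolation gives the secular equation, the normalization
and the orthogonality of the columns (`rotation_transpose_mul`, `add_vecMulVec_mul_rotation`).

A block-diagonal unitary `V` commutes with `diag α`, so `U V` is an eigenbasis whenever `U` is.
Conjugating the model problem by `U V` gives one step of the recursion (`IsDiagonalization.next`),
and induction gives all spectra and eigenbases. The norms follow from the traces.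

For the converse, the sorted spectra of the partial frame operators are eigensteps, by a
Courant–Fischer dimension count (`IsDiagonalization.interlaces`). It remains to see that a vector
`f` taking spectrum `α` to spectrum `β` comes from some `V`. By the matrix determinant lemma, the
characteristic polynomial of `diag α + g g*` determines the norm of `g` on each eigenspace of `diag
α`. Hence `g = Uᴴ f` and the model `v` have equal block norms, and a product of block reflections
carries one to the other (`IsDiagonalization.exists_nextVector_eq`). -/

namespace FrameSteps

/-! ### Counting and interlacing -/

section Counting

variable {M : ℕ} {α β : Fin M → ℝ}

/-- Antitone sequences are compared through their distribution functions. At the threshold `β m`, a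
failure at `m` would put every index up to `m` in the count for `α`, while the count for `β` only
reaches indices below `m`. -/
theorem le_of_count_le {n : ℕ} {α β : Fin n → ℝ} (hα : Antitone α) (hβ : Antitone β)
    (h : ∀ x, (Finset.univ.filter fun m => x < α m).card ≤
      (Finset.univ.filter fun m => x < β m).card) (m : Fin n) : α m ≤ β m := by
  by_contra! hlt
  have h1 : (Finset.Iic m).card ≤ (Finset.univ.filter fun k => β m < α k).card :=
    Finset.card_le_card fun k hk => by
      simpa using hlt.trans_le (hα (Finset.mem_Iic.1 hk))
  have h2 : (Finset.univ.filter fun k => β m < β k).card ≤ (Finset.Iio m).card :=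
    Finset.card_le_card fun k hk => by
      simp only [Finset.mem_filter, Finset.mem_univ, true_and] at hk
      rw [Finset.mem_Iio]
      by_contra! hmk
      exact absurd (hβ hmk) hk.not_ge
  have := h (β m)
  simp only [Fin.card_Iic, Fin.card_Iio] at h1 h2
  omega

theorem eq_of_count_eq {n : ℕ} {α β : Fin n → ℝ} (hα : Antitone α) (hβ : Antitone β)
    (h : ∀ x, (Finset.univ.filter fun m => x < α m).card =
      (Finset.univ.filter fun m => x < β m).card) : α = β :=
  funext fun m => le_antisymm (le_of_count_le hα hβ (fun x => (h x).le) m)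
    (le_of_count_le hβ hα (fun x => (h x).ge) m)

theorem interlaces_of_count (hα : Antitone α) (hβ : Antitone β)
    (h₁ : ∀ x, (Finset.univ.filter fun m => x < α m).card ≤
      (Finset.univ.filter fun m => x < β m).card)
    (h₂ : ∀ x, (Finset.univ.filter fun m => x < β m).card ≤
      (Finset.univ.filter fun m => x < α m).card + 1) : Interlaces α β := by
  refine ⟨le_of_count_le hα hβ h₁, fun m m' hm => ?_⟩
  by_contra! hlt
  have h3 : (Finset.Iic m').card ≤ (Finset.univ.filter fun k => α m < β k).card :=
    Finset.card_le_card fun k hk => by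
      simpa using hlt.trans_le (hβ (Finset.mem_Iic.1 hk))
  have h4 : (Finset.univ.filter fun k => α m < α k).card ≤ (Finset.Iio m).card :=
    Finset.card_le_card fun k hk => by
      simp only [Finset.mem_filter, Finset.mem_univ, true_and] at hk
      rw [Finset.mem_Iio]
      by_contra! hmk
      exact absurd (hα hmk) hk.not_ge
  have := h₂ (α m)
  simp only [Fin.card_Iic, Fin.card_Iio] at h3 h4
  omega

theorem Interlaces.count_le (h : Interlaces α β) {P : ℝ → Prop} [DecidablePred P]
    (hP : ∀ ⦃a b⦄, a ≤ b → P a → P b) :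
    (Finset.univ.filter fun m => P (α m)).card ≤ (Finset.univ.filter fun m => P (β m)).card :=
  Finset.card_le_card (Finset.monotone_filter_right _ fun m _ hm => hP (h.le m) hm)

/-- The shift `m ↦ m - 1` sends the nonzero indices counted for `β` injectively to indices counted
for `α`; index `0` accounts for the extra one. -/
theorem Interlaces.count_le_succ (h : Interlaces α β) {P : ℝ → Prop} [DecidablePred P]
    (hP : ∀ ⦃a b⦄, a ≤ b → P a → P b) :
    (Finset.univ.filter fun m => P (β m)).card ≤
      (Finset.univ.filter fun m => P (α m)).card + 1 := by
  set S := Finset.univ.filter fun m => P (β m) with hS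
  have h0 : (S.filter fun m : Fin M => (m : ℕ) = 0).card ≤ 1 := by
    rw [Finset.card_le_one]
    intro a ha b hb
    ext
    rw [(Finset.mem_filter.1 ha).2, (Finset.mem_filter.1 hb).2]
  have h1 : (S.filter fun m : Fin M => ¬ (m : ℕ) = 0).card ≤
      (Finset.univ.filter fun m => P (α m)).card := by
    refine Finset.card_le_card_of_injOn
      (fun m : Fin M => ⟨(m : ℕ) - 1, (Nat.sub_le _ _).trans_lt m.isLt⟩) ?_ ?_
    · intro m hm
      obtain ⟨hm1, hm2⟩ := Finset.mem_filter.1 hm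
      have hm1 := (Finset.mem_filter.1 hm1).2
      simp only [Finset.coe_filter, Finset.mem_univ, true_and, Set.mem_ofPred_eq]
      refine hP (h.succ_le _ m ?_) hm1
      simp only
      omega
    · intro a ha b hb hab
      have ha := (Finset.mem_filter.1 ha).2
      have hb := (Finset.mem_filter.1 hb).2
      simp only [Fin.mk.injEq] at hab
      ext
      omega
  rw [← Finset.card_filter_add_card_filter_not (s := S) fun m : Fin M => (m : ℕ) = 0]
  omega

theorem card_filter_le_eq (α : Fin M → ℝ) (x : ℝ) :
    (Finset.univ.filter fun m => x ≤ α m).card =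
      (Finset.univ.filter fun m => x < α m).card + valueMult α x := by
  rw [valueMult, ← Finset.card_union_of_disjoint]
  · congr 1
    ext m
    simp [le_iff_lt_or_eq, eq_comm]
  · rw [Finset.disjoint_filter]
    intro m _ h1 h2
    exact absurd h2 h1.ne'

theorem Interlaces.valueMult_le (h : Interlaces α β) (x : ℝ) :
    valueMult β x ≤ valueMult α x + 1 ∧ valueMult α x ≤ valueMult β x + 1 := by
  have := h.count_le (P := (x < ·)) fun _ _ hab hx => lt_of_lt_of_le hx hab
  have := h.count_le_succ (P := (x < ·)) fun _ _ hab hx => lt_of_lt_of_le hx hab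
  have := h.count_le (P := (x ≤ ·)) fun _ _ hab hx => le_trans hx hab
  have := h.count_le_succ (P := (x ≤ ·)) fun _ _ hab hx => le_trans hx hab
  have := card_filter_le_eq α x
  have := card_filter_le_eq β x
  omega

theorem mem_indexSet {m : Fin M} : m ∈ indexSet α β ↔
    (∀ m' < m, α m < α m') ∧ valueMult β (α m) < valueMult α (α m) := by
  simp [indexSet]

theorem indexSet_injOn (α β : Fin M → ℝ) : Set.InjOn α (indexSet α β) := by
  intro a ha b hb hab
  rcases lt_trichotomy a b with h | h | h
  · exact absurd hab ((mem_indexSet.1 hb).1 a h).ne'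
  · exact h
  · exact absurd hab ((mem_indexSet.1 ha).1 b h).ne

theorem indexSet_ne {i j : Fin M} (hi : i ∈ indexSet α β) (hj : j ∈ indexSet β α) :
    β j ≠ α i := by
  intro h
  have h1 := (mem_indexSet.1 hi).2
  have h2 := (mem_indexSet.1 hj).2
  rw [h] at h2
  omega

theorem exists_first (hα : Antitone α) {m : Fin M} :
    ∃ i, α i = α m ∧ ∀ m' < i, α i < α m' := by
  have hne : (Finset.univ.filter fun k => α k = α m).Nonempty := ⟨m, by simp⟩
  refine ⟨_, (Finset.mem_filter.1 (Finset.min'_mem _ hne)).2, fun m' hm' => ?_⟩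
  refine lt_of_le_of_ne (hα hm'.le) fun h => ?_
  refine absurd (Finset.min'_le _ m' ?_) hm'.not_ge
  rw [Finset.mem_filter]
  exact ⟨Finset.mem_univ _, h.symm.trans (Finset.mem_filter.1 (Finset.min'_mem _ hne)).2⟩

/-- A value in excess is represented exactly once, by its first occurrence. -/
theorem card_filter_indexSet (hα : Antitone α) (β : Fin M → ℝ) (x : ℝ) :
    ((indexSet α β).filter fun m => α m = x).card =
      if valueMult β x < valueMult α x then 1 else 0 := by
  split_ifs with h
  · apply le_antisymm
    · rw [Finset.card_le_one]
      intro a ha b hb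
      rw [Finset.mem_filter] at ha hb
      exact indexSet_injOn α β ha.1 hb.1 (ha.2.trans hb.2.symm)
    · have h0 : 0 < valueMult α x := by omega
      obtain ⟨m, hm⟩ := Finset.card_pos.1 h0
      obtain ⟨i, hi, hi'⟩ := exists_first hα (m := m)
      rw [(Finset.mem_filter.1 hm).2] at hi
      refine Finset.card_pos.2 ⟨i, Finset.mem_filter.2 ⟨mem_indexSet.2 ⟨hi', ?_⟩, hi⟩⟩
      rwa [hi]
  · rw [Finset.card_eq_zero, Finset.filter_eq_empty_iff]
    rintro m hm rfl
    exact h (mem_indexSet.1 hm).2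

theorem card_filter_comp_eq_sum {ι : Type*} (S : Finset ι) (a : ι → ℝ) (P : ℝ → Prop)
    [DecidablePred P] (T : Finset ℝ) (hT : ∀ i ∈ S, a i ∈ T) :
    (S.filter fun i => P (a i)).card = ∑ x ∈ T.filter P, (S.filter fun i => a i = x).card := by
  rw [Finset.card_eq_sum_card_fiberwise (f := a) (t := T.filter P)]
  · refine Finset.sum_congr rfl fun x hx => ?_
    rw [Finset.filter_filter]
    congr 1
    refine Finset.filter_congr fun i _ => ⟨fun h => h.2, fun h => ⟨?_, h⟩⟩
    rw [h]
    exact (Finset.mem_filter.1 hx).2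
  · intro i hi
    have hi := Finset.mem_filter.1 hi
    exact Finset.mem_coe.2 (Finset.mem_filter.2 ⟨hT i hi.1, hi.2⟩)

/-- As multisets, `α` without its entries on `indexSet α β` equals `β` without its entries on
`indexSet β α`. This holds value by value, since the multiplicities differ by at most one and one
copy is removed from the larger side. -/
theorem Interlaces.card_add (hα : Antitone α) (hβ : Antitone β) (h : Interlaces α β)
    (P : ℝ → Prop) [DecidablePred P] :
    (Finset.univ.filter fun m => P (α m)).card +
        ((indexSet β α).filter fun m => P (β m)).card =
      (Finset.univ.filter fun m => P (β m)).card +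
        ((indexSet α β).filter fun m => P (α m)).card := by
  set T := Finset.univ.image α ∪ Finset.univ.image β with hT
  have hα' : ∀ i, α i ∈ T := fun i => by simp [hT]
  have hβ' : ∀ i, β i ∈ T := fun i => by simp [hT]
  rw [card_filter_comp_eq_sum _ α P T fun i _ => hα' i,
    card_filter_comp_eq_sum _ β P T fun i _ => hβ' i,
    card_filter_comp_eq_sum _ α P T fun i _ => hα' i,
    card_filter_comp_eq_sum _ β P T fun i _ => hβ' i,
    ← Finset.sum_add_distrib, ← Finset.sum_add_distrib]
  refine Finset.sum_congr rfl fun x _ => ?_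
  rw [card_filter_indexSet hα, card_filter_indexSet hβ]
  have := h.valueMult_le x
  change valueMult α x + _ = valueMult β x + _
  split_ifs <;> omega

theorem Interlaces.card_indexSet_eq (hα : Antitone α) (hβ : Antitone β) (h : Interlaces α β) :
    (indexSet α β).card = (indexSet β α).card := by
  have := h.card_add hα hβ fun _ => True
  simp only [Finset.filter_true] at this
  omega

/-! ### Signs of the radicands -/

theorem prod_sub_sign {ι : Type*} [DecidableEq ι] (S : Finset ι) (b : ι → ℝ) (x : ℝ)
    (h : ∀ i ∈ S, b i ≠ x) :
    0 < (-1 : ℝ) ^ (S.filter fun i => x < b i).card * ∏ i ∈ S, (x - b i) := by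
  induction S using Finset.induction_on with
  | empty => simp
  | insert i S hi ih =>
    have ih := ih fun k hk => h k (Finset.mem_insert_of_mem hk)
    rw [Finset.prod_insert hi, Finset.filter_insert]
    rcases lt_or_gt_of_ne (h i (Finset.mem_insert_self _ _)) with hlt | hlt
    · rw [if_neg hlt.not_gt]
      have := mul_pos (sub_pos.2 hlt) ih
      linarith
    · rw [if_pos hlt, Finset.card_insert_of_notMem (by simp [hi]), pow_succ]
      have := mul_pos (sub_pos.2 hlt) ih
      linarith

theorem filter_lt_erase {ι : Type*} [DecidableEq ι] (S : Finset ι) (b : ι → ℝ) (i : ι) :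
    ((S.erase i).filter fun k => b i < b k) = S.filter fun k => b i < b k := by
  ext k
  simp only [Finset.mem_filter, Finset.mem_erase]
  exact ⟨fun hk => ⟨hk.1.2, hk.2⟩, fun hk => ⟨⟨fun e => by simp [e] at hk, hk.1⟩, hk.2⟩⟩

theorem prod_erase_sign (α β : Fin M → ℝ) {m : Fin M} (hm : m ∈ indexSet α β) :
    0 < (-1 : ℝ) ^ ((indexSet α β).filter fun i => α m < α i).card *
      ∏ i ∈ (indexSet α β).erase m, (α m - α i) := by
  rw [← filter_lt_erase]
  refine prod_sub_sign _ _ _ fun i hi e => ?_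
  rw [Finset.mem_erase] at hi
  exact hi.1 (indexSet_injOn α β hi.2 hm e)

theorem div_pos_of_sign {p q : ℝ} {k l : ℕ} (hp : 0 < (-1 : ℝ) ^ k * p)
    (hq : 0 < (-1 : ℝ) ^ l * q) : 0 < (-1 : ℝ) ^ (k + l) * (p / q) := by
  have := div_pos hp hq
  rw [mul_div_mul_comm] at this
  rw [pow_add]
  rcases neg_one_pow_eq_or ℝ l with h | h <;> rw [h] at this ⊢ <;> simpa [div_neg] using this

theorem Interlaces.stepWellDefined (hα : Antitone α) (hβ : Antitone β) (h : Interlaces α β) :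
    StepWellDefined α β where
  card_eq := h.card_indexSet_eq hα hβ
  denom_ne i hi j hj := sub_ne_zero.2 (indexSet_ne hi hj)
  radicandV_pos m hm := by
    have e1 := h.card_add hα hβ (α m < ·)
    have e2 := h.count_le_succ (P := (α m < ·)) fun _ _ hab hx => lt_of_lt_of_le hx hab
    have e3 := h.count_le (P := (α m ≤ ·)) fun _ _ hab hx => le_trans hx hab
    have e4 := card_filter_le_eq α (α m)
    have e5 := card_filter_le_eq β (α m)
    have e6 := (mem_indexSet.1 hm).2
    have s := div_pos_of_sign (prod_sub_sign (indexSet β α) β (α m)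
      fun j hj => indexSet_ne hm hj) (prod_erase_sign α β hm)
    -- Since `α m` has larger multiplicity in `α`, interlacing forces `β` to have exactly one more
    -- entry above `α m` than `α`. The total exponent is therefore odd and cancels the minus sign of
    -- the radicand.
    have e7 : ((indexSet β α).filter fun j => α m < β j).card =
      ((indexSet α β).filter fun i => α m < α i).card + 1 := by omega
    rw [e7, add_right_comm, pow_succ, Even.neg_one_pow ⟨_, rfl⟩] at s
    rw [radicandV]
    linarith
  radicandW_pos m hm := by
    have e1 := h.card_add hα hβ (β m < ·)
    have e2 := h.count_le (P := (β m < ·)) fun _ _ hab hx => lt_of_lt_of_le hx hab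
    have e3 := h.count_le_succ (P := (β m ≤ ·)) fun _ _ hab hx => le_trans hx hab
    have e4 := card_filter_le_eq α (β m)
    have e5 := card_filter_le_eq β (β m)
    have e6 := (mem_indexSet.1 hm).2
    have s := div_pos_of_sign (prod_sub_sign (indexSet α β) α (β m)
      fun i hi => (indexSet_ne hi hm).symm) (prod_erase_sign β α hm)
    -- Here the excess multiplicity lies in `β`, which forces equal counts above `β m` and an even
    -- total exponent.
    have e7 : ((indexSet β α).filter fun j => β m < β j).card =
      ((indexSet α β).filter fun i => β m < α i).card := by omega
    rw [e7, Even.neg_one_pow ⟨_, rfl⟩] at s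
    rw [radicandW]
    linarith

/-- Off the index sets, the two sequences agree in the order of the sorting permutations. -/
theorem Interlaces.sortPerm_compl (hα : Antitone α) (hβ : Antitone β) (h : Interlaces α β)
    {i j : Fin M} (hi : i ∉ indexSet α β) (hj : j ∉ indexSet β α)
    (hij : sortPerm (indexSet α β) i = sortPerm (indexSet β α) j) : α i = β j := by
  have hI : (indexSet α β)ᶜ.card = M - (indexSet α β).card := by
    rw [Finset.card_compl, Fintype.card_fin]
  have hc := h.card_indexSet_eq hα hβ
  have hJ : (indexSet β α)ᶜ.card = M - (indexSet β α).card := by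
    rw [Finset.card_compl, Fintype.card_fin]
  have hJ' : (indexSet β α)ᶜ.card = M - (indexSet α β).card := by rw [hJ, hc]
  have count : ∀ (S : Finset (Fin M)) (γ : Fin M → ℝ) (n : ℕ) (hS : Sᶜ.card = n) (x : ℝ),
      (Finset.univ.filter fun r => x < γ (Sᶜ.orderEmbOfFin hS r)).card +
        (S.filter fun m => x < γ m).card = (Finset.univ.filter fun m => x < γ m).card := by
    intro S γ n hS x
    have e : (Finset.univ.filter fun r => x < γ (Sᶜ.orderEmbOfFin hS r)).card =
        (Sᶜ.filter fun m => x < γ m).card := by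
      rw [← Finset.card_map (Sᶜ.orderEmbOfFin hS).toEmbedding]
      congr 1
      ext m
      simp only [Finset.mem_map, Finset.mem_filter, Finset.mem_univ, true_and]
      constructor
      · rintro ⟨r, hr, rfl⟩
        exact ⟨Finset.orderEmbOfFin_mem _ hS r, hr⟩
      · rintro ⟨hm, hx⟩
        have : m ∈ Set.range (Sᶜ.orderEmbOfFin hS) := by
          rw [Finset.range_orderEmbOfFin]; exact hm
        obtain ⟨r, rfl⟩ := this
        exact ⟨r, hx, rfl⟩
    rw [e, add_comm, ← Finset.card_union_of_disjoint, ← Finset.filter_union,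
      Finset.union_compl]
    exact Finset.disjoint_filter_filter disjoint_compl_right
  -- Both remainders, listed by increasing index, are antitone with the same distribution function.
  -- `hJ'` lets them share the index type.
  have key : (fun r => α ((indexSet α β)ᶜ.orderEmbOfFin hI r)) =
      fun r => β ((indexSet β α)ᶜ.orderEmbOfFin hJ' r) := by
    refine eq_of_count_eq (fun r s hrs => hα ((OrderEmbedding.monotone _) hrs))
      (fun r s hrs => hβ ((OrderEmbedding.monotone _) hrs)) fun x => ?_
    have e1 := count _ α _ hI x
    have e2 := count _ β _ hJ' x
    have e3 := h.card_add hα hβ (x < ·)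
    omega
  have hi' : i ∈ Set.range ((indexSet α β)ᶜ.orderEmbOfFin hI) := by
    rw [Finset.range_orderEmbOfFin]; simpa using hi
  have hj' : j ∈ Set.range ((indexSet β α)ᶜ.orderEmbOfFin hJ) := by
    rw [Finset.range_orderEmbOfFin]; simpa using hj
  obtain ⟨r, rfl⟩ := hi'
  obtain ⟨s, rfl⟩ := hj'
  have := congrArg Fin.val hij
  rw [sortPerm_orderEmb_compl, sortPerm_orderEmb_compl] at this
  have hrs : (r : ℕ) = s := by omega
  refine (congrFun key r).trans (congrArg β ?_)
  exact Finset.orderEmbOfFin_eq_orderEmbOfFin_iff.2 hrs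

end Counting

/-! ### A partial fraction decomposition -/

section PartialFractions

open Polynomial

variable {ι : Type*} [DecidableEq ι]

/-- Lagrange interpolation at the nodes `a i`: both sides have degree below `I.card`, and at `a i`
only the `i`-th summand survives. -/
theorem prod_erase_eq_sum {I J : Finset ι} {a b c : ι → ℝ} (hcard : I.card = J.card)
    (ha : Set.InjOn a I) (hab : ∀ i ∈ I, ∀ j ∈ J, b j ≠ a i)
    (hc : ∀ i ∈ I, c i = -((∏ k ∈ J, (a i - b k)) / ∏ k ∈ I.erase i, (a i - a k)))
    {j : ι} (hj : j ∈ J) :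
    ∏ k ∈ J.erase j, (X - C (b k)) =
      ∑ i ∈ I, C (c i / (b j - a i)) * ∏ k ∈ I.erase i, (X - C (a k)) := by
  have hpos : 0 < J.card := Finset.card_pos.2 ⟨j, hj⟩
  refine Polynomial.eq_of_degrees_lt_of_eval_index_eq I ha ?_ ?_ ?_
  · rw [degree_prod_of_monic _ _ fun k _ => monic_X_sub_C _]
    simp only [degree_X_sub_C, Finset.sum_const, Finset.card_erase_of_mem hj, hcard]
    rw [nsmul_one]
    exact_mod_cast Nat.sub_lt hpos one_pos
  · rw [← Polynomial.mem_degreeLT]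
    refine Submodule.sum_mem _ fun i hi => ?_
    rw [← smul_eq_C_mul]
    refine Submodule.smul_mem _ _ ?_
    rw [Polynomial.mem_degreeLT, degree_prod_of_monic _ _ fun k _ => monic_X_sub_C _]
    simp only [degree_X_sub_C, Finset.sum_const, Finset.card_erase_of_mem hi, hcard]
    rw [nsmul_one]
    exact_mod_cast Nat.sub_lt hpos one_pos
  · intro i hi
    have h0 : ∏ k ∈ I.erase i, (a i - a k) ≠ 0 := by
      refine Finset.prod_ne_zero_iff.2 fun k hk => sub_ne_zero.2 fun e => ?_
      rw [Finset.mem_erase] at hk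
      exact hk.1 (ha hk.2 hi e.symm)
    have h1 : b j - a i ≠ 0 := sub_ne_zero.2 (hab i hi j hj)
    rw [eval_finsetSum, Finset.sum_eq_single_of_mem i hi]
    · simp only [eval_mul, eval_C, eval_prod, eval_sub, eval_X]
      -- The factor `a i - b j` of the numerator cancels `b j - a i` up to the sign in `c i`.
      rw [hc i hi, ← Finset.mul_prod_erase J _ hj]
      field_simp
      ring
    · intro k hk hki
      simp only [eval_mul, eval_C, eval_prod, eval_sub, eval_X]
      rw [Finset.prod_eq_zero (i := i) (Finset.mem_erase.2 ⟨hki.symm, hi⟩) (by simp), mul_zero]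

variable {I J : Finset ι} {a b c : ι → ℝ} (hcard : I.card = J.card)
    (ha : Set.InjOn a I) (hab : ∀ i ∈ I, ∀ j ∈ J, b j ≠ a i)
    (hc : ∀ i ∈ I, c i = -((∏ k ∈ J, (a i - b k)) / ∏ k ∈ I.erase i, (a i - a k)))
    {j : ι} (hj : j ∈ J)

include hcard ha hab hc hj

/-- Leading coefficients of the interpolation identity. This is the secular equation making `b j` an
eigenvalue of `diag a + v vᵀ` when `c i = v i ^ 2`. -/
theorem sum_div_eq_one : ∑ i ∈ I, c i / (b j - a i) = 1 := by
  have h := congrArg (fun p => coeff p (J.card - 1)) (prod_erase_eq_sum hcard ha hab hc hj)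
  have key : ∀ (S : Finset ι) (d : ι → ℝ), (∏ k ∈ S, (X - C (d k))).coeff S.card = 1 := by
    intro S d
    have := (monic_prod_of_monic S _ fun k _ => monic_X_sub_C (d k)).coeff_natDegree
    rwa [natDegree_prod_of_monic _ _ fun k _ => monic_X_sub_C _, Finset.sum_congr rfl
      fun k _ => natDegree_X_sub_C (d k), Finset.sum_const, smul_eq_mul, mul_one] at this
  simp only [finsetSum_coeff, coeff_C_mul] at h
  rw [← Finset.card_erase_of_mem hj, key] at h
  rw [h]
  refine Finset.sum_congr rfl fun i hi => ?_
  rw [Finset.card_erase_of_mem hj, ← hcard, ← Finset.card_erase_of_mem hi, key, mul_one]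

theorem sum_div_mul_prod (x : ℝ) (hx : ∀ i ∈ I, x ≠ a i) :
    ∏ k ∈ J.erase j, (x - b k) =
      (∏ i ∈ I, (x - a i)) * ∑ i ∈ I, c i / ((b j - a i) * (x - a i)) := by
  have h := congrArg (eval x) (prod_erase_eq_sum hcard ha hab hc hj)
  simp only [eval_mul, eval_C, eval_prod, eval_sub, eval_X, eval_finsetSum] at h
  rw [h, Finset.mul_sum]
  refine Finset.sum_congr rfl fun i hi => ?_
  have h1 : x - a i ≠ 0 := sub_ne_zero.2 (hx i hi)
  have h2 : b j - a i ≠ 0 := sub_ne_zero.2 (hab i hi j hj)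
  rw [← Finset.mul_prod_erase I _ hi]
  field_simp

/-- Evaluation at `x = b j`. The value is the reciprocal of `radicandW`, so it normalizes the
columns of `W`. -/
theorem sum_div_sq : ∑ i ∈ I, c i / (b j - a i) ^ 2 =
    (∏ k ∈ J.erase j, (b j - b k)) / ∏ i ∈ I, (b j - a i) := by
  have h0 : ∏ i ∈ I, (b j - a i) ≠ 0 :=
    Finset.prod_ne_zero_iff.2 fun i hi => sub_ne_zero.2 (hab i hi j hj)
  rw [sum_div_mul_prod hcard ha hab hc hj (b j) fun i hi => hab i hi j hj,
    mul_div_cancel_left₀ _ h0]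
  simp only [sq]

/-- Evaluation at another root `x = b k`, where the left side vanishes: distinct columns of `W` are
orthogonal. -/
theorem sum_div_mul_eq_zero {k : ι} (hk : k ∈ J) (hkj : k ≠ j) :
    ∑ i ∈ I, c i / ((b j - a i) * (b k - a i)) = 0 := by
  have h0 : ∏ i ∈ I, (b k - a i) ≠ 0 :=
    Finset.prod_ne_zero_iff.2 fun i hi => sub_ne_zero.2 (hab i hi k hk)
  have h := sum_div_mul_prod hcard ha hab hc hj (b k) fun i hi => hab i hi k hk
  rw [Finset.prod_eq_zero (i := k) (Finset.mem_erase.2 ⟨hkj, hk⟩) (sub_self _)] at h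
  exact (mul_eq_zero.1 h.symm).resolve_left h0

end PartialFractions

/-! ### The matrix of one step -/

section StepMatrix

variable {M : ℕ} {α β : Fin M → ℝ}

theorem sortPerm_lt_card_iff (S : Finset (Fin M)) (m : Fin M) :
    (sortPerm S m : ℕ) < S.card ↔ m ∈ S := by
  refine ⟨fun h => ?_, (sortPerm_isSortPerm S).lt_card m⟩
  have e := sortPerm_orderEmb S ⟨_, h⟩
  have : S.orderEmbOfFin rfl ⟨_, h⟩ = m := (sortPerm S).injective (e.trans (Fin.ext rfl))
  rw [← this]
  exact Finset.orderEmbOfFin_mem _ _ _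

/-- The vector `Π_𝓘ᵀ [v; 0]`. -/
noncomputable def coeffV (α β : Fin M → ℝ) (m : Fin M) : ℝ :=
  if m ∈ indexSet α β then Real.sqrt (radicandV α β m) else 0

/-- The real matrix `Π_𝓘ᵀ diag(W, I) Π_𝓙`. -/
noncomputable def rotation (α β : Fin M → ℝ) : Matrix (Fin M) (Fin M) ℝ :=
  Matrix.of fun m m' =>
    if m ∈ indexSet α β ∧ m' ∈ indexSet β α then
      coeffV α β m * Real.sqrt (radicandW α β m') / (β m' - α m)
    else if sortPerm (indexSet α β) m = sortPerm (indexSet β α) m' then 1 else 0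

variable (𝕜 : Type*) [RCLike 𝕜]

/-- Together with `transpose_permMat_mul_padBlock`, this absorbs the permutations and the padding,
so that later arguments use only `coeffV` and `rotation`. -/
theorem transpose_permMat_mulVec_padVec (α β : Fin M → ℝ) :
    (permMat 𝕜 (indexSet α β))ᵀ *ᵥ padVec 𝕜 M (stepV α β) = fun m => ((coeffV α β m : ℝ) : 𝕜) := by
  rw [permMat, Matrix.transpose_permMatrix, Matrix.permMatrix_mulVec]
  ext m
  change padVec 𝕜 M (stepV α β) (sortPerm _ m) = _
  by_cases hm : m ∈ indexSet α β
  · rw [padVec, dif_pos ((sortPerm_lt_card_iff _ _).2 hm), stepV_sortPerm α β m hm, coeffV,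
      if_pos hm]
  · rw [padVec, dif_neg (mt (sortPerm_lt_card_iff _ _).1 hm), coeffV, if_neg hm]
    simp

theorem transpose_permMat_mul_padBlock (α β : Fin M → ℝ) :
    (permMat 𝕜 (indexSet α β))ᵀ * padBlock 𝕜 M (stepMatrix α β) * permMat 𝕜 (indexSet β α) =
      (rotation α β).map ((↑) : ℝ → 𝕜) := by
  ext m m'
  have : ((permMat 𝕜 (indexSet α β))ᵀ * padBlock 𝕜 M (stepMatrix α β) *
      permMat 𝕜 (indexSet β α)) m m' =
      padBlock 𝕜 M (stepMatrix α β) (sortPerm (indexSet α β) m)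
        (sortPerm (indexSet β α) m') := by
    rw [permMat, permMat, Matrix.transpose_permMatrix, Equiv.Perm.permMatrix,
      Equiv.Perm.permMatrix, PEquiv.toMatrix_toPEquiv_mul, PEquiv.mul_toMatrix_toPEquiv]
    rfl
  rw [this, padBlock, Matrix.map_apply, rotation, Matrix.of_apply, Matrix.of_apply]
  simp only [sortPerm_lt_card_iff]
  by_cases h : m ∈ indexSet α β ∧ m' ∈ indexSet β α
  · rw [dif_pos h, if_pos h, stepMatrix, Matrix.of_apply, stepV_sortPerm α β m h.1,
      stepW_sortPerm α β m' h.2, coeffV, if_pos h.1]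
    congr 1
    simp only [sortIndex, Fin.castLE_mk, Fin.eta, Equiv.symm_apply_apply]
    ring
  · rw [dif_neg h, if_neg h]
    split_ifs <;> simp

variable (hα : Antitone α) (hβ : Antitone β) (h : Interlaces α β)

include hα hβ h

theorem rotation_of_mem {j : Fin M} (hj : j ∈ indexSet β α) (m : Fin M) :
    rotation α β m j = if m ∈ indexSet α β then
      coeffV α β m * Real.sqrt (radicandW α β j) / (β j - α m) else 0 := by
  rw [rotation, Matrix.of_apply]
  by_cases hm : m ∈ indexSet α β
  · rw [if_pos ⟨hm, hj⟩, if_pos hm]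
  · rw [if_neg (fun hh => hm hh.1), if_neg hm, if_neg]
    -- A row outside `indexSet α β` is sorted to a position at or beyond the common cardinality, and
    -- column `j` to one before it.
    intro e
    refine hm ((sortPerm_lt_card_iff _ _).1 ?_)
    rw [e, h.card_indexSet_eq hα hβ]
    exact (sortPerm_lt_card_iff _ _).2 hj

theorem symm_sortPerm_notMem {j : Fin M} (hj : j ∉ indexSet β α) :
    (sortPerm (indexSet α β)).symm (sortPerm (indexSet β α) j) ∉ indexSet α β := by
  rw [← sortPerm_lt_card_iff, Equiv.apply_symm_apply, h.card_indexSet_eq hα hβ,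
    sortPerm_lt_card_iff]
  exact hj

omit hα hβ h in
theorem rotation_of_notMem {j : Fin M} (hj : j ∉ indexSet β α) (m : Fin M) :
    rotation α β m j =
      if m = (sortPerm (indexSet α β)).symm (sortPerm (indexSet β α) j) then 1 else 0 := by
  rw [rotation, Matrix.of_apply, if_neg (fun hh => hj hh.2)]
  simp only [Equiv.eq_symm_apply]

/-- In the new eigenbasis `v` becomes the zero-extended `w`. This is the secular equation multiplied
by the square root of `radicandW`. -/
theorem sum_coeffV_mul_rotation (j : Fin M) :
    ∑ m, coeffV α β m * rotation α β m j =
      if j ∈ indexSet β α then Real.sqrt (radicandW α β j) else 0 := by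
  have hw := h.stepWellDefined hα hβ
  split_ifs with hj
  · have := sum_div_eq_one hw.card_eq (indexSet_injOn α β) (fun i hi j hj => indexSet_ne hi hj)
      (c := radicandV α β) (fun i _ => rfl) hj
    rw [← mul_one (Real.sqrt _), ← this, Finset.mul_sum,
      ← Finset.sum_subset (Finset.subset_univ (indexSet α β))]
    · refine Finset.sum_congr rfl fun i hi => ?_
      rw [rotation_of_mem hα hβ h hj, if_pos hi, coeffV, if_pos hi]
      linear_combination (Real.sqrt (radicandW α β j) / (β j - α i)) *
        Real.mul_self_sqrt (hw.radicandV_pos i hi).le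
    · intro i _ hi
      rw [coeffV, if_neg hi, zero_mul]
  · refine Finset.sum_eq_zero fun m _ => ?_
    rw [rotation_of_notMem hj]
    split_ifs with hm
    · rw [hm, coeffV, if_neg (symm_sortPerm_notMem hα hβ h hj), zero_mul]
    · rw [mul_zero]

theorem rotation_transpose_mul : (rotation α β)ᵀ * rotation α β = 1 := by
  have hw := h.stepWellDefined hα hβ
  ext j k
  rw [Matrix.mul_apply]
  simp only [Matrix.transpose_apply]
  by_cases hj : j ∈ indexSet β α
  · by_cases hk : k ∈ indexSet β α
    · have e : ∑ m, rotation α β m j * rotation α β m k =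
          Real.sqrt (radicandW α β j) * Real.sqrt (radicandW α β k) *
            ∑ i ∈ indexSet α β, radicandV α β i / ((β j - α i) * (β k - α i)) := by
        rw [Finset.mul_sum, ← Finset.sum_subset (Finset.subset_univ (indexSet α β))]
        · refine Finset.sum_congr rfl fun i hi => ?_
          rw [rotation_of_mem hα hβ h hj, rotation_of_mem hα hβ h hk, if_pos hi, if_pos hi,
            coeffV, if_pos hi, div_mul_div_comm]
          -- Only the occurrence outside the square roots is split into a product of two roots.
          nth_rewrite 3 [← Real.mul_self_sqrt (hw.radicandV_pos i hi).le]
          ring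
        · intro i _ hi
          rw [rotation_of_mem hα hβ h hj, if_neg hi, zero_mul]
      rw [e]
      by_cases hjk : j = k
      · subst hjk
        rw [Matrix.one_apply_eq, Real.mul_self_sqrt (hw.radicandW_pos j hj).le]
        simp only [← sq]
        rw [sum_div_sq hw.card_eq (indexSet_injOn α β) (fun i hi j hj => indexSet_ne hi hj)
          (c := radicandV α β) (fun i _ => rfl) hj, radicandW, div_mul_div_comm, mul_comm,
          div_self]
        have hpos := (hw.radicandW_pos j hj).ne'
        rw [radicandW, div_ne_zero_iff] at hpos
        exact mul_ne_zero hpos.2 hpos.1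
      · rw [Matrix.one_apply_ne hjk, sum_div_mul_eq_zero hw.card_eq (indexSet_injOn α β)
          (fun i hi j hj => indexSet_ne hi hj) (c := radicandV α β) (fun i _ => rfl) hj hk
          (Ne.symm hjk), mul_zero]
    · rw [Matrix.one_apply_ne (by rintro rfl; exact hk hj)]
      refine Finset.sum_eq_zero fun m _ => ?_
      rw [rotation_of_mem hα hβ h hj, rotation_of_notMem hk]
      split_ifs with h1 h2
      · exact absurd h1 (h2 ▸ symm_sortPerm_notMem hα hβ h hk)
      all_goals simp
  · simp only [rotation_of_notMem hj, ite_mul, one_mul, zero_mul, Finset.sum_ite_eq',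
      Finset.mem_univ, if_true]
    by_cases hk : k ∈ indexSet β α
    · rw [rotation_of_mem hα hβ h hk, if_neg (symm_sortPerm_notMem hα hβ h hj),
        Matrix.one_apply_ne (by rintro rfl; exact hj hk)]
    · rw [rotation_of_notMem hk, Matrix.one_apply]
      simp

/-- On the Cauchy block this is `α m / (β j - α m) + 1 = β j / (β j - α m)`, multiplied by `v` and
`w`. Off it, column `j` is a unit vector on which `coeffV` vanishes, and the eigenvalues agree by
`Interlaces.sortPerm_compl`. -/
theorem add_vecMulVec_mul_rotation :
    (Matrix.diagonal α + Matrix.vecMulVec (coeffV α β) (coeffV α β)) * rotation α β =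
      rotation α β * Matrix.diagonal β := by
  ext m j
  rw [Matrix.add_mul, Matrix.add_apply, Matrix.diagonal_mul, Matrix.mul_diagonal,
    Matrix.vecMulVec_mul, Matrix.vecMulVec_apply]
  change _ + _ * ∑ i, coeffV α β i * rotation α β i j = _
  rw [sum_coeffV_mul_rotation hα hβ h]
  split_ifs with hj
  · rw [rotation_of_mem hα hβ h hj]
    split_ifs with hm
    · have := sub_ne_zero.2 (indexSet_ne hm hj)
      field_simp
      ring
    · rw [coeffV, if_neg hm]
      simp
  · rw [rotation_of_notMem hj]
    split_ifs with hm
    · have := h.sortPerm_compl hα hβ (i := m) (j := j)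
        (hm ▸ symm_sortPerm_notMem hα hβ h hj) hj (by rw [hm, Equiv.apply_symm_apply])
      simp [this]
    · simp

end StepMatrix

/-! ### Diagonalizations -/

section Diagonalization

variable {𝕜 : Type*} [RCLike 𝕜] {M : ℕ}

/-- `U` is unitary and diagonalizes `A`, with eigenvalues `α`. -/
structure IsDiagonalization (U A : Matrix (Fin M) (Fin M) 𝕜) (α : Fin M → ℝ) : Prop where
  unitary : U ∈ Matrix.unitaryGroup (Fin M) 𝕜
  eq : A = U * Matrix.diagonal (fun m => ((α m : ℝ) : 𝕜)) * Uᴴ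

theorem unitary_conjTranspose_mul {U : Matrix (Fin M) (Fin M) 𝕜}
    (hU : U ∈ Matrix.unitaryGroup (Fin M) 𝕜) : Uᴴ * U = 1 :=
  Matrix.mem_unitaryGroup_iff'.1 hU

theorem unitary_mul_conjTranspose {U : Matrix (Fin M) (Fin M) 𝕜}
    (hU : U ∈ Matrix.unitaryGroup (Fin M) 𝕜) : U * Uᴴ = 1 :=
  Matrix.mem_unitaryGroup_iff.1 hU

variable {U V A B : Matrix (Fin M) (Fin M) 𝕜} {α β : Fin M → ℝ}

theorem IsDiagonalization.mul_eq (h : IsDiagonalization U A α) :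
    A * U = U * Matrix.diagonal (fun m => ((α m : ℝ) : 𝕜)) := by
  rw [h.eq, Matrix.mul_assoc, unitary_conjTranspose_mul h.unitary, Matrix.mul_one]

theorem IsDiagonalization.of_mul_eq (hU : U ∈ Matrix.unitaryGroup (Fin M) 𝕜)
    (h : A * U = U * Matrix.diagonal (fun m => ((α m : ℝ) : 𝕜))) : IsDiagonalization U A α :=
  ⟨hU, by rw [← h, Matrix.mul_assoc, unitary_mul_conjTranspose hU, Matrix.mul_one]⟩

theorem IsDiagonalization.hasSpectrum (h : IsDiagonalization U A α) : HasSpectrum A α := by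
  rw [HasSpectrum, h.eq, Matrix.charpoly_mul_comm, ← Matrix.mul_assoc,
    unitary_conjTranspose_mul h.unitary, Matrix.one_mul, Matrix.charpoly_diagonal]

theorem IsDiagonalization.trace_eq (h : IsDiagonalization U A α) :
    A.trace = ((∑ m, α m : ℝ) : 𝕜) := by
  rw [h.eq, Matrix.trace_mul_comm, ← Matrix.mul_assoc,
    unitary_conjTranspose_mul h.unitary, Matrix.one_mul, Matrix.trace_diagonal]
  simp

theorem IsDiagonalization.mul_diagonalization (hU : U ∈ Matrix.unitaryGroup (Fin M) 𝕜)
    (h : IsDiagonalization V A α) : IsDiagonalization (U * V) (U * A * Uᴴ) α :=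
  ⟨mul_mem hU h.unitary, by rw [h.eq, Matrix.conjTranspose_mul]; simp only [Matrix.mul_assoc]⟩

theorem IsDiagonalization.isOrthonormalEigenbasis (h : IsDiagonalization U A α) :
    IsOrthonormalEigenbasis U A α := by
  have ho : Orthonormal 𝕜 (column U) := by
    rw [orthonormal_iff_ite]
    intro i j
    have := congrFun (congrFun (unitary_conjTranspose_mul h.unitary) i) j
    rw [Matrix.one_apply, Matrix.mul_apply] at this
    rw [← this, column, column, EuclideanSpace.inner_eq_star_dotProduct, dotProduct]
    refine Finset.sum_congr rfl fun k _ => ?_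
    simp [mul_comm]
  have hc : Fintype.card (Fin M) = Module.finrank 𝕜 (EuclideanSpace 𝕜 (Fin M)) := by simp
  refine ⟨OrthonormalBasis.mk ho ?_, fun m => ?_⟩
  · rw [ho.linearIndependent.span_eq_top_of_card_eq_finrank' hc]
  · rw [OrthonormalBasis.coe_mk]
    refine ⟨rfl, ?_⟩
    ext i
    have := congrFun (congrFun h.mul_eq i) m
    rw [Matrix.mul_diagonal, mul_comm] at this
    exact this

theorem IsBlockUnitary.commute (h : IsBlockUnitary α V) :
    V * Matrix.diagonal (fun m => ((α m : ℝ) : 𝕜)) =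
      Matrix.diagonal (fun m => ((α m : ℝ) : 𝕜)) * V := by
  ext i j
  rw [Matrix.mul_diagonal, Matrix.diagonal_mul]
  by_cases hij : α i = α j
  · rw [hij, mul_comm]
  · rw [h.2 i j hij, zero_mul, mul_zero]

theorem IsDiagonalization.mul_block (h : IsDiagonalization U A α) (hV : IsBlockUnitary α V) :
    IsDiagonalization (U * V) A α :=
  .of_mul_eq (mul_mem h.unitary hV.1) (by
    rw [← Matrix.mul_assoc, h.mul_eq, Matrix.mul_assoc, Matrix.mul_assoc, hV.commute])

theorem nextVector_eq (α β : Fin M → ℝ) (U V : Matrix (Fin M) (Fin M) 𝕜) :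
    nextVector α β U V = WithLp.toLp 2 ((U * V) *ᵥ fun m => ((coeffV α β m : ℝ) : 𝕜)) := by
  rw [nextVector, ← Matrix.mulVec_mulVec, transpose_permMat_mulVec_padVec]

theorem nextBasis_eq (α β : Fin M → ℝ) (U V : Matrix (Fin M) (Fin M) 𝕜) :
    nextBasis α β U V = U * V * (rotation α β).map ((↑) : ℝ → 𝕜) := by
  rw [nextBasis, ← transpose_permMat_mul_padBlock]
  simp only [Matrix.mul_assoc]

/-- The rank-one operator `f f*`. -/
noncomputable def rankOne (f : Fin M → 𝕜) : Matrix (Fin M) (Fin M) 𝕜 :=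
  Matrix.vecMulVec f (star f)

theorem rankOne_mulVec (B : Matrix (Fin M) (Fin M) 𝕜) (f : Fin M → 𝕜) :
    rankOne (B *ᵥ f) = B * rankOne f * Bᴴ := by
  rw [rankOne, rankOne, Matrix.star_mulVec, Matrix.mul_vecMulVec, Matrix.vecMulVec_mul]

theorem isDiagonalization_rotation (hα : Antitone α) (hβ : Antitone β) (h : Interlaces α β) :
    IsDiagonalization ((rotation α β).map ((↑) : ℝ → 𝕜))
      (Matrix.diagonal (fun m => ((α m : ℝ) : 𝕜)) + rankOne fun m => ((coeffV α β m : ℝ) : 𝕜))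
      β := by
  refine .of_mul_eq (Matrix.mem_unitaryGroup_iff'.2 ?_) ?_
  · have := congrArg (fun X : Matrix _ _ ℝ => X.map (algebraMap ℝ 𝕜))
      (rotation_transpose_mul hα hβ h)
    simp only [Matrix.map_mul, Matrix.map_one _ (map_zero _) (map_one _)] at this
    rw [← this]
    congr 1
    ext i j
    simp
  · have := congrArg (fun X : Matrix _ _ ℝ => X.map (algebraMap ℝ 𝕜))
      (add_vecMulVec_mul_rotation hα hβ h)
    simp only [Matrix.map_mul, Matrix.diagonal_map (map_zero (algebraMap ℝ 𝕜))] at this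
    refine Eq.trans ?_ this
    congr 1
    ext i j
    simp [rankOne, Matrix.vecMulVec_apply, Matrix.diagonal_apply]
    split_ifs <;> simp

/-- One step of the recursion. -/
theorem IsDiagonalization.next (hα : Antitone α) (hβ : Antitone β) (h : Interlaces α β)
    (hU : IsDiagonalization U A α) (hV : IsBlockUnitary α V) :
    IsDiagonalization (nextBasis α β U V) (A + rankOne (nextVector α β U V)) β := by
  have hUV := hU.mul_block hV
  -- Conjugation by `U V` turns `diag α` into `A` and the model vector into `nextVector`.
  have := IsDiagonalization.mul_diagonalization hUV.unitary
    (isDiagonalization_rotation (𝕜 := 𝕜) hα hβ h)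
  rw [Matrix.mul_add, Matrix.add_mul, ← hUV.eq, ← rankOne_mulVec] at this
  rw [nextBasis_eq, nextVector_eq]
  exact this

end Diagonalization

/-! ### Eigenvalues of rank-one perturbations -/

section Perturbation

variable {𝕜 : Type*} [RCLike 𝕜] {M : ℕ} {U V A B : Matrix (Fin M) (Fin M) 𝕜} {α β : Fin M → ℝ}

/-- The roots of the characteristic polynomial recover the values as a multiset, and an antitone
sequence is determined by its multiset of values. -/
theorem hasSpectrum_unique (hα : Antitone α) (hβ : Antitone β)
    (h₁ : HasSpectrum A α) (h₂ : HasSpectrum A β) : α = β := by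
  have h := congrArg Polynomial.roots (h₁.symm.trans h₂)
  have key : ∀ γ : Fin M → ℝ,
      (∏ m, (Polynomial.X - Polynomial.C ((γ m : ℝ) : 𝕜))).roots =
        (Finset.univ.val.map γ).map ((↑) : ℝ → 𝕜) := by
    intro γ
    rw [Finset.prod, ← Polynomial.roots_multiset_prod_X_sub_C
      ((Finset.univ.val.map γ).map ((↑) : ℝ → 𝕜)), Multiset.map_map, Multiset.map_map]
    rfl
  rw [key, key] at h
  have h := Multiset.map_injective RCLike.ofReal_injective h
  refine eq_of_count_eq hα hβ fun x => ?_
  have := congrArg (Multiset.countP (x < ·)) h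
  rwa [Multiset.countP_map, Multiset.countP_map] at this

/-- The quadratic form of `A`. -/
noncomputable def quadForm (A : Matrix (Fin M) (Fin M) 𝕜) (z : Fin M → 𝕜) : ℝ :=
  RCLike.re (star z ⬝ᵥ (A *ᵥ z))

theorem quadForm_conj (U A : Matrix (Fin M) (Fin M) 𝕜) (z : Fin M → 𝕜) :
    quadForm (U * A * Uᴴ) z = quadForm A (Uᴴ *ᵥ z) := by
  rw [quadForm, quadForm, Matrix.star_mulVec, Matrix.conjTranspose_conjTranspose,
    ← Matrix.mulVec_mulVec, ← Matrix.mulVec_mulVec, Matrix.dotProduct_mulVec]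

theorem quadForm_diagonal (α : Fin M → ℝ) (z : Fin M → 𝕜) :
    quadForm (Matrix.diagonal fun m => ((α m : ℝ) : 𝕜)) z = ∑ m, α m * ‖z m‖ ^ 2 := by
  rw [quadForm, dotProduct, map_sum]
  refine Finset.sum_congr rfl fun m _ => ?_
  rw [Matrix.mulVec_diagonal, Pi.star_apply, RCLike.star_def, mul_left_comm, RCLike.conj_mul]
  norm_cast

theorem quadForm_one (z : Fin M → 𝕜) :
    quadForm (1 : Matrix (Fin M) (Fin M) 𝕜) z = ∑ m, ‖z m‖ ^ 2 := by
  have := quadForm_diagonal (fun _ => 1) z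
  simpa using this

theorem quadForm_add_rankOne (A : Matrix (Fin M) (Fin M) 𝕜) (f z : Fin M → 𝕜) :
    quadForm (A + rankOne f) z = quadForm A z + ‖star f ⬝ᵥ z‖ ^ 2 := by
  rw [quadForm, quadForm, Matrix.add_mulVec, dotProduct_add, map_add, rankOne,
    Matrix.vecMulVec_mulVec]
  congr 1
  have : star z ⬝ᵥ f = star (star f ⬝ᵥ z) := by
    rw [Matrix.star_dotProduct]
  rw [dotProduct_smul, this]
  simp [RCLike.conj_mul]

theorem IsDiagonalization.quadForm_eq (h : IsDiagonalization U A α) (z : Fin M → 𝕜) :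
    quadForm A z = ∑ m, α m * ‖(Uᴴ *ᵥ z) m‖ ^ 2 := by
  rw [h.eq, quadForm_conj, quadForm_diagonal]

theorem IsDiagonalization.sum_norm_sq (h : IsDiagonalization U A α) (z : Fin M → 𝕜) :
    ∑ m, ‖(Uᴴ *ᵥ z) m‖ ^ 2 = ∑ m, ‖z m‖ ^ 2 := by
  rw [← quadForm_one, ← quadForm_conj, Matrix.mul_one, unitary_mul_conjTranspose h.unitary,
    quadForm_one]

theorem exists_ne_zero_of_card_lt {ι : Type*} [Fintype ι] (φ : ι → (Fin M → 𝕜) →ₗ[𝕜] 𝕜)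
    (h : Fintype.card ι < M) : ∃ z ≠ 0, ∀ i, φ i z = 0 := by
  have := LinearMap.ker_ne_bot_of_finrank_lt (f := LinearMap.pi φ) (by simpa using h)
  obtain ⟨z, hz, hz0⟩ := Submodule.exists_mem_ne_zero_of_ne_bot this
  exact ⟨z, hz0, fun i => congrFun (LinearMap.mem_ker.1 hz) i⟩

/-- Courant–Fischer by dimension count. If the bound failed, some `z ≠ 0` would be orthogonal to the
eigenvectors of `A` with eigenvalue at most `x` and to those of `B` with eigenvalue above `x`, and
be killed by every `ψ i`. Then `quadForm A z > x ‖z‖² ≥ quadForm B z` in the Euclidean norm. -/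
theorem IsDiagonalization.count_le {k : ℕ} (ψ : Fin k → (Fin M → 𝕜) →ₗ[𝕜] 𝕜)
    (hA : IsDiagonalization U A α) (hB : IsDiagonalization V B β)
    (hAB : ∀ z, (∀ i, ψ i z = 0) → quadForm A z ≤ quadForm B z) (x : ℝ) :
    (Finset.univ.filter fun m => x < α m).card ≤
      (Finset.univ.filter fun m => x < β m).card + k := by
  by_contra! hlt
  obtain ⟨z, hz0, hz⟩ := exists_ne_zero_of_card_lt (M := M) (𝕜 := 𝕜)
    (ι := {m // ¬ x < α m} ⊕ {m // x < β m} ⊕ Fin k)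
    (Sum.elim (fun m => LinearMap.proj m.1 ∘ₗ Uᴴ.mulVecLin)
      (Sum.elim (fun m => LinearMap.proj m.1 ∘ₗ Vᴴ.mulVecLin) ψ)) (by
        have := Finset.card_filter_add_card_filter_not (s := Finset.univ) fun m => x < α m
        rw [Finset.card_univ, Fintype.card_fin] at this
        rw [Fintype.card_sum, Fintype.card_sum, Fintype.card_fin, Fintype.card_subtype,
          Fintype.card_subtype]
        omega)
  have h1 : ∀ m, ¬ x < α m → (Uᴴ *ᵥ z) m = 0 := fun m hm => hz (Sum.inl ⟨m, hm⟩)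
  have h2 : ∀ m, x < β m → (Vᴴ *ᵥ z) m = 0 := fun m hm => hz (Sum.inr (Sum.inl ⟨m, hm⟩))
  have h3 := hAB z fun i => hz (Sum.inr (Sum.inr i))
  rw [hA.quadForm_eq, hB.quadForm_eq] at h3
  have h4 : ∑ m, β m * ‖(Vᴴ *ᵥ z) m‖ ^ 2 ≤ ∑ m, x * ‖(Vᴴ *ᵥ z) m‖ ^ 2 := by
    refine Finset.sum_le_sum fun m _ => ?_
    by_cases hm : x < β m
    · rw [h2 m hm]
      simp
    · exact mul_le_mul_of_nonneg_right (not_lt.1 hm) (sq_nonneg _)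
  have h5 : ∑ m, x * ‖(Uᴴ *ᵥ z) m‖ ^ 2 < ∑ m, α m * ‖(Uᴴ *ᵥ z) m‖ ^ 2 := by
    refine Finset.sum_lt_sum (fun m _ => ?_) ?_
    · by_cases hm : x < α m
      · exact mul_le_mul_of_nonneg_right hm.le (sq_nonneg _)
      · rw [h1 m hm]
        simp
    · have : Uᴴ *ᵥ z ≠ 0 := by
        intro h0
        apply hz0
        rw [← Matrix.one_mulVec z, ← unitary_mul_conjTranspose hA.unitary,
          ← Matrix.mulVec_mulVec, h0, Matrix.mulVec_zero]
      obtain ⟨m, hm⟩ := Function.ne_iff.1 this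
      refine ⟨m, Finset.mem_univ _, mul_lt_mul_of_pos_right ?_
        (pow_pos (norm_pos_iff.2 hm) 2)⟩
      by_contra hx
      exact hm (h1 m hx)
  rw [← Finset.mul_sum, hB.sum_norm_sq] at h4
  rw [← Finset.mul_sum, hA.sum_norm_sq] at h5
  linarith

/-- Eigenvalue interlacing for a rank-one perturbation. -/
theorem IsDiagonalization.interlaces (hα : Antitone α) (hβ : Antitone β) {f : Fin M → 𝕜}
    (hA : IsDiagonalization U A α) (hB : IsDiagonalization V (A + rankOne f) β) :
    Interlaces α β := by
  refine interlaces_of_count hα hβ (fun x => ?_) fun x => ?_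
  -- Adding `f f*` only increases the quadratic form.
  · refine hA.count_le (k := 0) Fin.elim0 hB (fun z _ => ?_) x
    rw [quadForm_add_rankOne]
    linarith [sq_nonneg ‖star f ⬝ᵥ z‖]
  -- On the hyperplane orthogonal to `f` the two forms agree, which costs one linear condition.
  · refine hB.count_le (k := 1) (fun _ => dotProductBilin 𝕜 𝕜 (star f)) hA (fun z hz => ?_) x
    have hz : star f ⬝ᵥ z = 0 := hz 0
    rw [quadForm_add_rankOne, hz]
    simp

theorem exists_isDiagonalization (hA : A.IsHermitian) :
    ∃ (U : Matrix (Fin M) (Fin M) 𝕜) (α : Fin M → ℝ), Antitone α ∧ IsDiagonalization U A α := by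
  set E : Matrix (Fin M) (Fin M) 𝕜 := hA.eigenvectorUnitary.1 with hE
  have hd : IsDiagonalization E A hA.eigenvalues :=
    ⟨hA.eigenvectorUnitary.2, by
      conv_lhs => rw [hA.spectral_theorem, Unitary.conjStarAlgAut_apply]
      rfl⟩
  set σ := Tuple.sort fun m => - hA.eigenvalues m with hσ
  refine ⟨E.submatrix id σ, hA.eigenvalues ∘ σ, fun a b hab => ?_, .of_mul_eq ?_ ?_⟩
  · have := Tuple.monotone_sort (fun m => - hA.eigenvalues m) hab
    simpa using this
  · rw [Matrix.mem_unitaryGroup_iff']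
    change (E.submatrix id σ)ᴴ * _ = 1
    rw [Matrix.conjTranspose_submatrix, ← Matrix.submatrix_mul _ _ _ _ _ Function.bijective_id,
      unitary_conjTranspose_mul hd.unitary, Matrix.submatrix_one_equiv]
  · ext i j
    have := congrFun (congrFun hd.mul_eq i) (σ j)
    rw [Matrix.mul_diagonal] at this ⊢
    exact this

end Perturbation

/-! ### Recovering a step from its vector -/

section Recover

variable {𝕜 : Type*} [RCLike 𝕜] {M : ℕ} {U V A B : Matrix (Fin M) (Fin M) 𝕜} {α β : Fin M → ℝ}

/-- Matrix determinant lemma, after factoring `y - diag α` out of `y - diag α - g g*`. It is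
evaluated only at real `y` off the values of `α`, where that factor is invertible. -/
theorem eval_charpoly_diagonal_add_rankOne (α : Fin M → ℝ) (g : Fin M → 𝕜) {y : ℝ}
    (hy : ∀ m, y ≠ α m) :
    (Matrix.diagonal (fun m => ((α m : ℝ) : 𝕜)) + rankOne g).charpoly.eval (y : 𝕜) =
      (((∏ m, (y - α m)) * (1 - ∑ m, ‖g m‖ ^ 2 / (y - α m)) : ℝ) : 𝕜) := by
  have h0 : ∀ m, ((y - α m : ℝ) : 𝕜) ≠ 0 := fun m =>
    RCLike.ofReal_ne_zero.2 (sub_ne_zero.2 (hy m))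
  have e : Matrix.scalar (Fin M) (y : 𝕜) -
      (Matrix.diagonal (fun m => ((α m : ℝ) : 𝕜)) + rankOne g) =
      Matrix.diagonal (fun m => ((y - α m : ℝ) : 𝕜)) *
        (1 + Matrix.replicateCol Unit (fun m => -(((y - α m : ℝ) : 𝕜)⁻¹ * g m)) *
          Matrix.replicateRow Unit (star g)) := by
    rw [← Matrix.vecMulVec_eq, Matrix.mul_add, Matrix.mul_one]
    ext i j
    rw [Matrix.add_apply, Matrix.diagonal_mul, Matrix.vecMulVec_apply, neg_mul, mul_neg,
      mul_assoc, mul_inv_cancel_left₀ (h0 i)]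
    rcases eq_or_ne i j with rfl | hij
    · simp [rankOne, Matrix.vecMulVec_apply]
      ring
    · simp [rankOne, Matrix.vecMulVec_apply, hij]
  rw [Matrix.eval_charpoly, e, Matrix.det_mul, Matrix.det_diagonal,
    Matrix.det_one_add_replicateCol_mul_replicateRow, dotProduct]
  push_cast
  congr 1
  rw [sub_eq_add_neg, ← Finset.sum_neg_distrib]
  congr 1
  refine Finset.sum_congr rfl fun m _ => ?_
  rw [Pi.star_apply, RCLike.star_def, mul_neg, mul_left_comm, RCLike.conj_mul]
  ring

/-- The residue at `x`: multiply by `y - x` and let `y → x` through points avoiding all poles. -/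
theorem sum_block_eq_zero {h : Fin M → ℝ}
    (hz : ∀ y, (∀ m, y ≠ α m) → ∑ m, h m / (y - α m) = 0) (x : ℝ) :
    ∑ m, (if α m = x then h m else 0) = 0 := by
  have hne : ∀ m, ∀ᶠ y in nhdsWithin x {x}ᶜ, y ≠ α m := by
    intro m
    by_cases hm : α m = x
    · rw [hm]
      exact self_mem_nhdsWithin
    · exact nhdsWithin_le_nhds (isOpen_ne.mem_nhds (Ne.symm hm))
  have h1 : Filter.Tendsto (fun y => ∑ m, (y - x) * (h m / (y - α m))) (nhdsWithin x {x}ᶜ)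
      (nhds (∑ m, (if α m = x then h m else 0))) := by
    refine tendsto_finsetSum _ fun m _ => ?_
    split_ifs with hm
    · refine tendsto_const_nhds.congr' ?_
      filter_upwards [self_mem_nhdsWithin] with y hy
      rw [hm, mul_div_cancel₀ _ (sub_ne_zero.2 hy)]
    · have : ContinuousAt (fun y => (y - x) * (h m / (y - α m))) x :=
        (continuousAt_id.sub continuousAt_const).mul (continuousAt_const.div
          (continuousAt_id.sub continuousAt_const) (sub_ne_zero.2 (Ne.symm hm)))
      have := this.tendsto
      rw [sub_self, zero_mul] at this
      exact this.mono_left nhdsWithin_le_nhds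
  refine tendsto_nhds_unique h1 (tendsto_const_nhds.congr' ?_)
  filter_upwards [Filter.eventually_all.2 hne] with y hy
  rw [← Finset.mul_sum, hz y hy, mul_zero]

theorem block_norms_eq {g c : Fin M → 𝕜}
    (h : (Matrix.diagonal (fun m => ((α m : ℝ) : 𝕜)) + rankOne g).charpoly =
      (Matrix.diagonal (fun m => ((α m : ℝ) : 𝕜)) + rankOne c).charpoly) (x : ℝ) :
    ∑ m, (if α m = x then ‖g m‖ ^ 2 else 0) = ∑ m, (if α m = x then ‖c m‖ ^ 2 else 0) := by
  have := sum_block_eq_zero (α := α) (h := fun m => ‖g m‖ ^ 2 - ‖c m‖ ^ 2) (fun y hy => ?_) x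
  · rw [← sub_eq_zero, ← Finset.sum_sub_distrib, ← this]
    refine Finset.sum_congr rfl fun m _ => ?_
    split_ifs <;> simp
  · have e := congrArg (Polynomial.eval (y : 𝕜)) h
    rw [eval_charpoly_diagonal_add_rankOne α g hy, eval_charpoly_diagonal_add_rankOne α c hy] at e
    have e := mul_left_cancel₀
      (Finset.prod_ne_zero_iff.2 fun m _ => sub_ne_zero.2 (hy m)) (RCLike.ofReal_injective e)
    simp only [sub_div, Finset.sum_sub_distrib]
    linarith

/-- A block-diagonal unitary matrix, a product of complex Householder reflections of the blocks,
that maps one vector to another one whose blocks have the same norms. -/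
theorem exists_isBlockUnitary {c g : Fin M → 𝕜}
    (h : ∀ x, ∑ m, (if α m = x then ‖g m‖ ^ 2 else 0) =
      ∑ m, (if α m = x then ‖c m‖ ^ 2 else 0)) :
    ∃ V, IsBlockUnitary α V ∧ V *ᵥ c = g := by
  set w : Fin M → 𝕜 := c - g with hw
  -- `t x` is the inner product of `w` and `c` on the block of value `x`. On each block the
  -- reflection is `1 - w w* / t`, which also works over `ℂ`.
  set t : ℝ → 𝕜 := fun x => ∑ m, if α m = x then star (w m) * c m else 0 with ht
  -- Equality of the block norms of `c = g + w` and `g` is precisely `‖w‖² = 2 Re ⟨w, c⟩` on each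
  -- block.
  have hN : ∀ x, (∑ m, if α m = x then star (w m) * w m else 0) = t x + star (t x) := by
    intro x
    have e : ((∑ m, (if α m = x then ‖g m‖ ^ 2 else 0) : ℝ) : 𝕜) =
        ((∑ m, (if α m = x then ‖c m‖ ^ 2 else 0) : ℝ) : 𝕜) := by rw [h x]
    push_cast [apply_ite (RCLike.ofReal (K := 𝕜))] at e
    rw [← sub_eq_zero] at e ⊢
    rw [ht, star_sum, ← Finset.sum_add_distrib, ← Finset.sum_sub_distrib]
    rw [← Finset.sum_sub_distrib] at e
    refine (Finset.sum_congr rfl fun m _ => ?_).trans e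
    split_ifs
    · simp only [hw, Pi.sub_apply, star_sub, star_mul', RCLike.star_def,
        starRingEnd_self_apply, ← RCLike.conj_mul]
      ring
    · simp
  -- A block with `t = 0` has `w = 0`, so division by zero makes `K` vanish there, as it should.
  have hw0 : ∀ i, t (α i) = 0 → w i = 0 := by
    intro i hi
    have e := hN (α i)
    rw [hi, star_zero, add_zero] at e
    have e' : ((∑ m, (if α m = α i then ‖w m‖ ^ 2 else 0) : ℝ) : 𝕜) = 0 := by
      rw [← e]
      push_cast [apply_ite (RCLike.ofReal (K := 𝕜))]
      refine Finset.sum_congr rfl fun m _ => ?_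
      rw [RCLike.star_def, RCLike.conj_mul]
    rw [RCLike.ofReal_eq_zero, Finset.sum_eq_zero_iff_of_nonneg] at e'
    · have := e' i (Finset.mem_univ _)
      simpa using this
    · intro m _
      split_ifs <;> positivity
  set K : Matrix (Fin M) (Fin M) 𝕜 :=
    Matrix.of fun i j => if α i = α j then w i * star (w j) / t (α j) else 0 with hK
  -- This identity is equivalent to `(1 - K)ᴴ * (1 - K) = 1`.
  have hKK : Kᴴ * K = Kᴴ + K := by
    ext i j
    rw [Matrix.mul_apply, Matrix.add_apply]
    simp only [Matrix.conjTranspose_apply, hK, Matrix.of_apply]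
    by_cases hij : α i = α j
    · rw [if_pos hij, if_pos hij.symm, hij]
      have e : ∀ k, (star (if α k = α j then w k * star (w i) / t (α j) else 0) *
          if α k = α j then w k * star (w j) / t (α j) else 0) =
          w i * star (w j) / (star (t (α j)) * t (α j)) *
            (if α k = α j then star (w k) * w k else 0) := by
        intro k
        split_ifs
        · simp only [star_div₀, star_mul', star_star]
          ring
        · simp
      rw [Finset.sum_congr rfl fun k _ => e k, ← Finset.mul_sum, hN]
      by_cases h0 : t (α j) = 0
      · simp [hw0 j h0]
      · have h0' : star (t (α j)) ≠ 0 := star_ne_zero.2 h0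
        simp only [star_div₀, star_mul', star_star]
        field_simp
    · rw [if_neg hij, if_neg (Ne.symm hij), star_zero, add_zero]
      refine Finset.sum_eq_zero fun k _ => ?_
      split_ifs with h1 h2
      · exact absurd (h1.symm.trans h2) hij
      all_goals simp
  refine ⟨1 - K, ⟨?_, fun i j hij => ?_⟩, ?_⟩
  · rw [Matrix.mem_unitaryGroup_iff']
    change (1 - K)ᴴ * (1 - K) = 1
    simp only [Matrix.conjTranspose_sub, Matrix.conjTranspose_one, Matrix.sub_mul,
      Matrix.mul_sub, Matrix.one_mul, Matrix.mul_one, hKK]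
    abel
  · rw [Matrix.sub_apply, Matrix.one_apply_ne (fun e => hij (by rw [e])), hK, Matrix.of_apply,
      if_neg hij, sub_zero]
  · rw [Matrix.sub_mulVec, Matrix.one_mulVec]
    have : K *ᵥ c = w := by
      ext i
      have e : ∀ j, K i j * c j =
          w i / t (α i) * (if α j = α i then star (w j) * c j else 0) := by
        intro j
        rw [hK, Matrix.of_apply]
        by_cases hij : α i = α j
        · rw [if_pos hij, if_pos hij.symm, hij]
          ring
        · rw [if_neg hij, if_neg (Ne.symm hij)]
          simp
      change ∑ j, K i j * c j = w i
      rw [Finset.sum_congr rfl fun j _ => e j, ← Finset.mul_sum]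
      change w i / t (α i) * t (α i) = w i
      by_cases h0 : t (α i) = 0
      · simp [hw0 i h0]
      · rw [div_mul_cancel₀ _ h0]
    rw [this, hw, sub_sub_cancel]

/-- Every vector that changes the spectrum from `α` to `β` arises in a step. -/
theorem IsDiagonalization.exists_nextVector_eq (hα : Antitone α) (hβ : Antitone β)
    (h : Interlaces α β) {f : EuclideanSpace 𝕜 (Fin M)} (hU : IsDiagonalization U A α)
    (hB : HasSpectrum (A + rankOne f) β) :
    ∃ V, IsBlockUnitary α V ∧ nextVector α β U V = f := by
  have hf : U *ᵥ (Uᴴ *ᵥ f) = f := by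
    rw [Matrix.mulVec_mulVec, unitary_mul_conjTranspose hU.unitary, Matrix.one_mulVec]
  have e : A + rankOne f = U * (Matrix.diagonal (fun m => ((α m : ℝ) : 𝕜)) +
      rankOne (Uᴴ *ᵥ f)) * Uᴴ := by
    rw [Matrix.mul_add, Matrix.add_mul, ← hU.eq, ← rankOne_mulVec, hf]
  obtain ⟨V, hV, hVc⟩ := exists_isBlockUnitary (α := α)
    -- In the coordinates of `U`, both `f` and the model vector perturb `diag α` to the spectrum
    -- `β`, so their block norms agree.
    (c := fun m => ((coeffV α β m : ℝ) : 𝕜)) (g := Uᴴ *ᵥ f) (block_norms_eq (by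
      refine Eq.trans ?_ (isDiagonalization_rotation hα hβ h).hasSpectrum.symm
      rw [← hB, e, Matrix.charpoly_mul_comm, ← Matrix.mul_assoc,
        unitary_conjTranspose_mul hU.unitary, Matrix.one_mul]))
  refine ⟨V, hV, ?_⟩
  rw [nextVector_eq, ← Matrix.mulVec_mulVec, hVc, hf]

end Recover

/-! ### Partial frame operators -/

section PartialOperators

variable {𝕜 : Type*} [RCLike 𝕜] {M N : ℕ}

theorem frameOperator_eq_sum (f : Fin N → EuclideanSpace 𝕜 (Fin M)) :
    frameOperator f = ∑ j, rankOne (f j) := by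
  ext i k
  rw [frameOperator, Matrix.mul_apply, Matrix.sum_apply]
  rfl

/-- The frame operator of the first `n` vectors of `f`, for `n = 0, …, N`. -/
noncomputable def partialOperator (f : Fin N → EuclideanSpace 𝕜 (Fin M)) (n : Fin (N + 1)) :
    Matrix (Fin M) (Fin M) 𝕜 :=
  ∑ j with j.castSucc < n, rankOne (f j)

theorem filter_castSucc_lt_succ (n : Fin N) :
    (Finset.univ.filter fun j : Fin N => j.castSucc < n.succ) = Finset.Iic n := by
  ext j
  simp

theorem sum_castSucc_lt_succ {E : Type*} [AddCommMonoid E] (g : Fin N → E) (n : Fin N) :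
    ∑ j with j.castSucc < n.succ, g j = (∑ j with j.castSucc < n.castSucc, g j) + g n := by
  have : (Finset.univ.filter fun j : Fin N => j.castSucc < n.succ) =
      insert n (Finset.univ.filter fun j : Fin N => j.castSucc < n.castSucc) := by
    ext j
    simp [le_iff_eq_or_lt]
  rw [this, Finset.sum_insert (by simp), add_comm]

variable (f : Fin N → EuclideanSpace 𝕜 (Fin M))

theorem partialOperator_zero : partialOperator f 0 = 0 := by
  simp [partialOperator]

theorem partialOperator_succ (n : Fin N) :
    partialOperator f n.succ = partialOperator f n.castSucc + rankOne (f n) :=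
  sum_castSucc_lt_succ _ n

theorem partialOperator_last : partialOperator f (Fin.last N) = frameOperator f := by
  rw [partialOperator, frameOperator_eq_sum, Finset.filter_true_of_mem]
  exact fun j _ => Fin.castSucc_lt_last j

theorem frameOperator_partialSeq (n : Fin N) :
    frameOperator (partialSeq f n) = partialOperator f n.succ := by
  rw [frameOperator_eq_sum, partialOperator]
  refine Finset.sum_bij (fun j _ => Fin.castLE n.isLt j) (fun j _ => ?_) (fun i _ j _ h => ?_)
    (fun j hj => ?_) fun j _ => rfl
  · rw [Finset.mem_filter, Fin.lt_def]
    exact ⟨Finset.mem_univ _, j.isLt⟩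
  · exact Fin.castLE_injective _ h
  · rw [Finset.mem_filter, Fin.lt_def] at hj
    exact ⟨⟨j, hj.2⟩, Finset.mem_univ _, rfl⟩

theorem rankOne_isHermitian (g : Fin M → 𝕜) : (rankOne g).IsHermitian := by
  rw [Matrix.IsHermitian, rankOne, Matrix.conjTranspose_vecMulVec, star_star]

theorem partialOperator_isHermitian (n : Fin (N + 1)) : (partialOperator f n).IsHermitian := by
  rw [Matrix.IsHermitian, partialOperator, Matrix.conjTranspose_sum]
  exact Finset.sum_congr rfl fun j _ => rankOne_isHermitian _

theorem trace_rankOne (g : EuclideanSpace 𝕜 (Fin M)) :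
    (rankOne g).trace = ((‖g‖ ^ 2 : ℝ) : 𝕜) := by
  rw [EuclideanSpace.norm_sq_eq, Matrix.trace]
  push_cast
  refine Finset.sum_congr rfl fun m _ => ?_
  rw [Matrix.diag_apply, rankOne, Matrix.vecMulVec_apply, Pi.star_apply, RCLike.star_def,
    RCLike.mul_conj]

theorem trace_partialOperator (n : Fin (N + 1)) :
    (partialOperator f n).trace = ((∑ j with j.castSucc < n, ‖f j‖ ^ 2 : ℝ) : 𝕜) := by
  rw [partialOperator, Matrix.trace_sum]
  push_cast
  refine Finset.sum_congr rfl fun j _ => ?_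
  rw [trace_rankOne]
  push_cast
  rfl

theorem isDiagonalization_zero {U : Matrix (Fin M) (Fin M) 𝕜}
    (hU : U ∈ Matrix.unitaryGroup (Fin M) 𝕜) : IsDiagonalization U 0 fun _ => 0 :=
  ⟨hU, by simp⟩

/-- The sorted spectra of the partial frame operators are eigensteps. -/
theorem exists_isEigensteps {lam : Fin M → ℝ} {mu : Fin N → ℝ} (hlam : Antitone lam)
    (hf : HasSpectrum (frameOperator f) lam) (hmu : ∀ n, ‖f n‖ ^ 2 = mu n) :
    ∃ Λ : Fin (N + 1) → Fin M → ℝ, IsEigensteps lam mu Λ ∧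
      ∀ n, HasSpectrum (partialOperator f n) (Λ n) := by
  choose U Λ hΛ hU using fun n => exists_isDiagonalization (partialOperator_isHermitian f n)
  have hint : ∀ n : Fin N, Interlaces (Λ n.castSucc) (Λ n.succ) := fun n =>
    (hU n.castSucc).interlaces (f := f n) (hΛ _) (hΛ _) (by
      have := hU n.succ
      rwa [partialOperator_succ] at this)
  have h0 : Λ 0 = fun _ => 0 := by
    have := (hU 0).hasSpectrum
    rw [partialOperator_zero] at this
    exact hasSpectrum_unique (hΛ 0) antitone_const this
      (isDiagonalization_zero (one_mem _)).hasSpectrum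
  refine ⟨Λ, ⟨fun n => ?_, hΛ, fun m => by rw [h0], fun m => ?_, hint, fun n => ?_⟩,
    fun n => (hU n).hasSpectrum⟩
  -- Nonnegativity propagates from the zero spectrum at `n = 0` by interlacing.
  · induction n using Fin.induction with
    | zero => exact fun m => by rw [h0]
    | succ n ih => exact fun m => (ih m).trans ((hint n).le m)
  · have := (hU (Fin.last N)).hasSpectrum
    rw [partialOperator_last] at this
    rw [hasSpectrum_unique (hΛ _) hlam this hf]
  · have := (hU n.succ).trace_eq
    rw [trace_partialOperator] at this
    rw [← RCLike.ofReal_injective this, filter_castSucc_lt_succ]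
    exact Finset.sum_congr rfl fun j _ => hmu j

end PartialOperators

/-! ### The algorithm -/

section Algorithm

variable {𝕜 : Type*} [RCLike 𝕜] {M K : ℕ} [NeZero M] {lam : Fin M → ℝ} {mu : Fin (K + 1) → ℝ}
  {Λ : Fin (K + 1 + 1) → Fin M → ℝ}

/-- Interlacing with the zero sequence kills every entry but the first, and the trace condition
fixes that one. -/
theorem IsEigensteps.first_eq (h : IsEigensteps lam mu Λ) :
    Λ 1 = fun m => if m = 0 then mu 0 else 0 := by
  have hint := h.interlaces 0
  have h1 : ∀ m, m ≠ 0 → Λ 1 m = 0 := by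
    intro m hm
    have hm' : (m : ℕ) ≠ 0 := fun e => hm (Fin.ext e)
    refine le_antisymm ?_ (h.nonneg _ _)
    have := hint.succ_le ⟨(m : ℕ) - 1, (Nat.sub_le _ _).trans_lt m.isLt⟩ m (by simp only; omega)
    rw [Fin.castSucc_zero, h.initial] at this
    exact this
  have h2 : Λ 1 0 = mu 0 := by
    have := h.trace 0
    have e : Finset.Iic (0 : Fin (K + 1)) = {0} := by
      ext j
      simp
    rw [e, Finset.sum_singleton] at this
    rw [← this]
    exact (Finset.sum_eq_single_of_mem 0 (Finset.mem_univ _) fun m _ hm => h1 m hm).symm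
  ext m
  split_ifs with hm
  · rw [hm, h2]
  · exact h1 m hm

theorem column_smul_eq (U : Matrix (Fin M) (Fin M) 𝕜) (a : 𝕜) :
    ((a • column U 0 : EuclideanSpace 𝕜 (Fin M)) : Fin M → 𝕜) = U *ᵥ Pi.single 0 a := by
  ext i
  simp [column, mul_comm]

theorem IsEigensteps.isDiagonalization_first (h : IsEigensteps lam mu Λ) (hmu : 0 ≤ mu 0)
    {U : Matrix (Fin M) (Fin M) 𝕜} (hU : U ∈ Matrix.unitaryGroup (Fin M) 𝕜) :
    IsDiagonalization U
      (rankOne (((Real.sqrt (mu 0) : ℝ) : 𝕜) • column U 0 : EuclideanSpace 𝕜 (Fin M)))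
      (Λ 1) := by
  refine ⟨hU, ?_⟩
  rw [column_smul_eq, rankOne_mulVec]
  congr 2
  ext i j
  rw [h.first_eq, rankOne, Matrix.vecMulVec_apply, Pi.star_apply, Matrix.diagonal_apply,
    Pi.single_apply, Pi.single_apply]
  by_cases hi : i = 0
  · by_cases hj : j = 0
    · subst hi hj
      simp only [if_true, RCLike.star_def, RCLike.conj_ofReal]
      rw [← RCLike.ofReal_mul, Real.mul_self_sqrt hmu]
    · have hij : i ≠ j := fun e => hj (e.symm.trans hi)
      simp [hj, hij]
  · simp [hi]

variable {U₁ : Matrix (Fin M) (Fin M) 𝕜} {V : Fin K → Matrix (Fin M) (Fin M) 𝕜}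

theorem IsEigensteps.isDiagonalization_bases (h : IsEigensteps lam mu Λ) (hmu : 0 ≤ mu 0)
    (hV : IsChoice Λ U₁ V) (n : Fin (K + 1)) :
    IsDiagonalization (bases Λ U₁ V n) (partialOperator (vectors mu Λ U₁ V) n.succ)
      (Λ n.succ) := by
  induction n using Fin.induction with
  | zero =>
    rw [partialOperator_succ, Fin.castSucc_zero, partialOperator_zero, zero_add]
    exact h.isDiagonalization_first hmu hV.unitary
  | succ k ih =>
    rw [partialOperator_succ, ← Fin.succ_castSucc]
    exact ih.next (h.antitone _) (h.antitone _) (h.interlaces k.succ) (hV.blocks k)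

theorem IsEigensteps.norm_sq_vectors (h : IsEigensteps lam mu Λ) (hmu : 0 ≤ mu 0)
    (hV : IsChoice Λ U₁ V) (n : Fin (K + 1)) : ‖vectors mu Λ U₁ V n‖ ^ 2 = mu n := by
  have key : ∀ n : Fin (K + 1 + 1), ∑ j with j.castSucc < n, ‖vectors mu Λ U₁ V j‖ ^ 2 =
      ∑ j with j.castSucc < n, mu j := by
    intro n
    induction n using Fin.cases with
    | zero => simp
    | succ n =>
      have := (h.isDiagonalization_bases hmu hV n).trace_eq
      rw [trace_partialOperator] at this
      rw [RCLike.ofReal_injective this, h.trace, filter_castSucc_lt_succ]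
  -- The trace gives the partial sums of squared norms; subtracting consecutive ones isolates one
  -- vector.
  have h1 := key n.succ
  rw [sum_castSucc_lt_succ, sum_castSucc_lt_succ, key] at h1
  exact add_left_cancel h1

theorem exists_unitary_smul_column {f : EuclideanSpace 𝕜 (Fin M)} {r : ℝ} (hr : 0 ≤ r)
    (hf : ‖f‖ ^ 2 = r) :
    ∃ U ∈ Matrix.unitaryGroup (Fin M) 𝕜, ((Real.sqrt r : ℝ) : 𝕜) • column U 0 = f := by
  -- A constant `α` has a single block, so the block condition is void; the case `r = 0` needs no
  -- separate treatment.
  obtain ⟨U, hU, hUf⟩ := exists_isBlockUnitary (α := fun _ : Fin M => 0)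
    (c := Pi.single 0 ((Real.sqrt r : ℝ) : 𝕜)) (g := (f : Fin M → 𝕜)) (fun x => by
      split_ifs
      · rw [← EuclideanSpace.norm_sq_eq, hf, Finset.sum_eq_single_of_mem 0 (Finset.mem_univ _)]
        · simp [Real.sq_sqrt hr, abs_of_nonneg]
        · intro m _ hm
          simp [hm]
      · rfl)
  refine ⟨U, hU.1, ?_⟩
  ext i
  rw [column_smul_eq, hUf]

theorem IsEigensteps.exists_choice (h : IsEigensteps lam mu Λ) (hmu : 0 ≤ mu 0)
    {f : Fin (K + 1) → EuclideanSpace 𝕜 (Fin M)} (hf : ‖f 0‖ ^ 2 = mu 0)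
    (hΛ : ∀ n, HasSpectrum (partialOperator f n) (Λ n)) :
    ∃ (U₁ : Matrix (Fin M) (Fin M) 𝕜) (V : Fin K → Matrix (Fin M) (Fin M) 𝕜),
      IsChoice Λ U₁ V ∧ f = vectors mu Λ U₁ V := by
  obtain ⟨U₁, hU₁, hf₁⟩ := exists_unitary_smul_column hmu hf
  -- A suitable `V` depends on the basis `U` reached so far. It is chosen for every matrix `U`, with
  -- the junk value `1` when `U` is not an eigenbasis, so that the recursion `Us` can be defined
  -- before its correctness is known.
  have step : ∀ (k : Fin K) (U : Matrix (Fin M) (Fin M) 𝕜), ∃ V,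
      IsDiagonalization U (partialOperator f k.castSucc.succ) (Λ k.castSucc.succ) →
        IsBlockUnitary (Λ k.castSucc.succ) V ∧
          nextVector (Λ k.castSucc.succ) (Λ k.succ.succ) U V = f k.succ := by
    intro k U
    by_cases hU : IsDiagonalization U (partialOperator f k.castSucc.succ) (Λ k.castSucc.succ)
    · obtain ⟨V, hV⟩ := hU.exists_nextVector_eq (f := f k.succ) (h.antitone _)
        (h.antitone k.succ.succ) (h.interlaces k.succ) (by
          have := hΛ k.succ.succ
          rwa [partialOperator_succ] at this)
      exact ⟨V, fun _ => hV⟩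
    · exact ⟨1, fun hU' => absurd hU' hU⟩
  choose g hg using step
  let Us : Fin (K + 1) → Matrix (Fin M) (Fin M) 𝕜 :=
    Fin.induction (motive := fun _ => Matrix (Fin M) (Fin M) 𝕜) U₁
      fun k U => nextBasis (Λ k.castSucc.succ) (Λ k.succ.succ) U (g k U)
  have hUs : ∀ n, IsDiagonalization (Us n) (partialOperator f n.succ) (Λ n.succ) := by
    intro n
    induction n using Fin.induction with
    | zero =>
      rw [partialOperator_succ, Fin.castSucc_zero, partialOperator_zero, zero_add, ← hf₁]
      exact h.isDiagonalization_first hmu hU₁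
    | succ k ih =>
      have hk := hg k _ ih
      -- `k.succ.castSucc` and `k.castSucc.succ` agree definitionally.
      have hint : Interlaces (Λ k.castSucc.succ) (Λ k.succ.succ) := h.interlaces k.succ
      have := ih.next (h.antitone _) (h.antitone _) hint hk.1
      rw [hk.2] at this
      rw [partialOperator_succ]
      exact this
  -- With the choices frozen along `Us`, the recursion of the algorithm reproduces `Us`.
  have hbases : bases Λ U₁ (fun k => g k (Us k.castSucc)) = Us := by
    ext1 n
    induction n using Fin.induction with
    | zero => rfl
    | succ k ih =>
      change nextBasis _ _ (bases Λ U₁ (fun k => g k (Us k.castSucc)) k.castSucc)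
        (g k (Us k.castSucc)) = nextBasis _ _ (Us k.castSucc) (g k (Us k.castSucc))
      rw [ih]
  refine ⟨U₁, fun k => g k (Us k.castSucc), ⟨hU₁, fun k => (hg k _ (hUs k.castSucc)).1⟩, ?_⟩
  ext1 n
  induction n using Fin.cases with
  | zero => exact hf₁.symm
  | succ k =>
    rw [vectors, Fin.cons_succ, hbases]
    exact (hg k _ (hUs k.castSucc)).2.symm

end Algorithm

end FrameSteps

theorem mainTheorem1 {𝕜 : Type*} [RCLike 𝕜] {M K : ℕ} [NeZero M]
    (lam : Fin M → ℝ) (mu : Fin (K + 1) → ℝ)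
    (hlam_nonneg : ∀ m, 0 ≤ lam m) (hlam_antitone : Antitone lam)
    (hmu_nonneg : ∀ n, 0 ≤ mu n) (hmu_antitone : Antitone mu) :
    -- every sequence of vectors with these data is produced by the algorithm
    (∀ f : Fin (K + 1) → EuclideanSpace 𝕜 (Fin M),
      HasSpectrum (frameOperator f) lam → (∀ n, ‖f n‖ ^ 2 = mu n) →
        ∃ Λ : Fin (K + 1 + 1) → Fin M → ℝ, IsEigensteps lam mu Λ ∧
          ∃ (U₁ : Matrix (Fin M) (Fin M) 𝕜) (V : Fin K → Matrix (Fin M) (Fin M) 𝕜),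
            IsChoice Λ U₁ V ∧ f = vectors mu Λ U₁ V) ∧
    -- the algorithm is well defined, and whatever it produces has these data
    (∀ Λ : Fin (K + 1 + 1) → Fin M → ℝ, IsEigensteps lam mu Λ →
      (∀ k : Fin K, StepWellDefined (Λ k.castSucc.succ) (Λ k.succ.succ)) ∧
      ∀ (U₁ : Matrix (Fin M) (Fin M) 𝕜) (V : Fin K → Matrix (Fin M) (Fin M) 𝕜),
        IsChoice Λ U₁ V →
          HasSpectrum (frameOperator (vectors mu Λ U₁ V)) lam ∧
          (∀ n, ‖vectors mu Λ U₁ V n‖ ^ 2 = mu n) ∧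
          ∀ n : Fin (K + 1),
            HasSpectrum (frameOperator (partialSeq (vectors mu Λ U₁ V) n)) (Λ n.succ) ∧
            IsOrthonormalEigenbasis (bases Λ U₁ V n)
              (frameOperator (partialSeq (vectors mu Λ U₁ V) n)) (Λ n.succ)) := by
  refine ⟨fun f hf hnorm => ?_, fun Λ hΛ => ⟨fun k => ?_, fun U₁ V hV => ?_⟩⟩
  · obtain ⟨Λ, hΛ, hspec⟩ := exists_isEigensteps f hlam_antitone hf hnorm
    exact ⟨Λ, hΛ, hΛ.exists_choice (hmu_nonneg 0) (hnorm 0) hspec⟩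
  · exact (hΛ.interlaces k.succ).stepWellDefined (hΛ.antitone _) (hΛ.antitone _)
  · have hd := hΛ.isDiagonalization_bases (hmu_nonneg 0) hV
    refine ⟨?_, hΛ.norm_sq_vectors (hmu_nonneg 0) hV, fun n => ?_⟩
    · have := (hd (Fin.last K)).hasSpectrum
      rwa [Fin.succ_last, partialOperator_last, funext hΛ.final] at this
    · rw [frameOperator_partialSeq]
      exact ⟨(hd n).hasSpectrum, (hd n).isOrthonormalEigenbasis⟩
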